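/- Let $X=\mathbb R^p$, $U=\mathbb R^q$, let $\Omega_0\subseteq X$ and $M\subseteq\Omega_0\times U$ be open, and let $n\ge 1$. Write $U^{(n)}$ for the space with coordinates $u^\alpha_J$ ($1\le\alpha\le q$, $J$ an unordered multi-index of order at most $n$ with entries in $\{1,\dots,p\}$), $\mathrm{pr}^{(n)}f(x)=(\partial_Jf^\alpha(x))_{\alpha,J}$ for the $n$-jet of a smooth function $f$, and $M^{(n)}=\{(x,u^{(n)})\in X\times U^{(n)}:(x,u)\in M\}$. Let $L:M^{(n)}\to\mathbb R$ be smooth. Let $G$ be a connected local transformation group on $M$: a Lie group $G$, an open set $\mathcal U\subseteq G\times M$ containing $\{e\}\times M$ and a smooth map $\mathcal U\to M$, $(g,m)\mapsto g\cdot m$, such that $e\cdot m=m$; $g\cdot(h\cdot m)=(gh)\cdot m$ whenever $(h,m),(g,h\cdot m),(gh,m)\in\mathcal U$; $(g^{-1},g\cdot m)\in\mathcal U$ whenever $(g,m)\in\mathcal U$; and $M$, $G$, $\mathcal U$ and all sets $\mathcal U_m=\{g:(g,m)\in\mathcal U\}$ are connected. Write $g\cdot(x,u)=(\Xi_g(x,u),\Phi_g(x,u))$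 and $J_g=(D_j\Xi_g^i)_{i,j}$, where $D_jP=\partial_{x^j}P+\sum_\alpha u^\alpha_j\,\partial_{u^\alpha}P$. The infinitesimal generators of $G$ are the vector fields $v(m)=T_e(g\mapsto g\cdot m)(w)$ on $M$, $w\in T_eG$. For a smooth function $f$ on an open set $\Omega\subseteq X$ with graph $\Gamma_f\subseteq M$ and for $g\in G$, say that $g\cdot f$ is defined and equal to the smooth function $\tilde f$ on the open set $\tilde\Omega$ if $g\cdot\Gamma_f=\Gamma_{\tilde f}$ and if for every $x\in\Omega$ the element $g$ lies in the connected component of $e$ in $\{h\in\mathcal U_{(x,f(x))}:\det J_h(x,\mathrm{pr}^{(1)}f(x))\neq0\}$. Call $G$ a variational symmetry group of $\int_{\Omega_0}L(x,u^{(n)})\,dx$ if for every connected open $\Omega$ with $\overline\Omega\subseteq\Omega_0$, every smooth $f:\Omega\to U$ with graph in $M$ and every $g\in G$ such that $\tilde f=g\cdot f$ is defined, on $\tilde\Omega\subseteq\Omega_0$, $$\int_{\tilde\Omega}L(\tilde x,\mathrm{pr}^{(n)}\tilde f(\tilde x))\,d\tilde x=\int_\Omega L(x,\mathrm{pr}^{(n)}f(x))\,dx,$$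 where one integral exists if and only if the other one does. For a local diffeomorphism $\psi=(\Xi,\Phi)$ of $M$, put $\mathrm{pr}^{(n)}\psi\,(x,u^{(n)})=(\tilde x,\mathrm{pr}^{(n)}\tilde f(\tilde x))$, where $\tilde x=\Xi(x,u)$, $f$ is the Taylor polynomial with $\mathrm{pr}^{(n)}f(x)=u^{(n)}$, and $\tilde f$ is the smooth function near $\tilde x$ whose graph is the image under $\psi$ of the graph of $f$ near $x$. For a vector field $v$ on $M$ with flow $\mathrm{Fl}^v_\varepsilon$, put $\mathrm{pr}^{(n)}v|_z=\frac{d}{d\varepsilon}\big|_{0}\,\mathrm{pr}^{(n)}(\mathrm{Fl}^v_\varepsilon)(z)$ for $z\in M^{(n)}$. Then $G$ is a variational symmetry group of $\int_{\Omega_0}L(x,u^{(n)})\,dx$ if and only if $$\mathrm{pr}^{(n)}v(L)+L\cdot\mathrm{Div}\,\xi=0\quad\text{on }M^{(n)}$$ for every infinitesimal generator $v=\sum_i\xi^i(x,u)\,\partial_{x^i}+\sum_\alpha\phi_\alpha(x,u)\,\partial_{u^\alpha}$ of $G$, where $\mathrm{Div}\,\xi=\sum_iD_i\xi^i$. -/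

import Mathlib

open Set MeasureTheory Topology
open scoped Manifold ContDiff

noncomputable section

namespace VarSym

/-! ### Jets -/

/-- The space `X = ℝ^p` of independent variables. -/
abbrev IndepVar (p : ℕ) : Type := Fin p → ℝ

/-- The space `U = ℝ^q` of dependent variables. -/
abbrev DepVar (q : ℕ) : Type := Fin q → ℝ

/-- The total space `X × U`. -/
abbrev TotalSpace (p q : ℕ) : Type := IndepVar p × DepVar q

/-- Unordered multi-indices `J = (j₁, …, j_k)` with entries in `{1, …, p}` and `0 ≤ k ≤ n`. -/
abbrev MultiIndex (p n : ℕ) : Type := Σ k : Fin (n + 1), Sym (Fin p) k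

/-- The space `U^(n)`, with coordinates `u^α_J`. -/
abbrev DepJet (p q n : ℕ) : Type := MultiIndex p n → DepVar q

/-- The jet space `X × U^(n)`. -/
abbrev JetSpace (p q n : ℕ) : Type := IndepVar p × DepJet p q n

variable {p q n : ℕ}

/-- The zeroth order part `(x, u)` of a jet `(x, u^(n))`. -/
def JetSpace.base (z : JetSpace p q n) : TotalSpace p q := (z.1, z.2 ⟨0, Sym.nil⟩)

/-- The first order coordinates `u_i` of a jet of order at least one. -/
def JetSpace.first (hn : 1 ≤ n) (z : JetSpace p q n) (i : Fin p) : DepVar q :=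
  z.2 ⟨⟨1, Nat.lt_succ_of_le hn⟩, Sym.oneEquiv i⟩

/-- `M^(n) = M × U₁ × … × U_n`. -/
def jetSet (n : ℕ) (M : Set (TotalSpace p q)) : Set (JetSpace p q n) := {z | z.base ∈ M}

/-- The partial derivative `∂_J f (x)` for a list `J` of coordinate indices. -/
def partialDeriv (J : List (Fin p)) (f : IndepVar p → DepVar q) (x : IndepVar p) : DepVar q :=
  iteratedFDeriv ℝ J.length f x fun k => Pi.single (J.get k) 1

/-- The prolongation `pr^(n) f (x)`, with coordinates `u^α_J = ∂_J f^α (x)`. -/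
def prolongFun (n : ℕ) (f : IndepVar p → DepVar q) (x : IndepVar p) : DepJet p q n :=
  fun J => partialDeriv ((J.2 : Multiset (Fin p)).sort (· ≤ ·)) f x

/-- The Taylor polynomial `y ↦ ∑_J u_J / J! · (y - x)^J` with the jet `(x, u^(n))` at `x`. -/
def taylorFun (z : JetSpace p q n) (y : IndepVar p) : DepVar q :=
  ∑ J : MultiIndex p n,
    ((((J.2 : Multiset (Fin p)).map fun i => y i - z.1 i).prod) /
      ((∏ i : Fin p, ((J.2 : Multiset (Fin p)).count i).factorial : ℕ) : ℝ)) • z.2 J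

/-! ### Prolongation of transformations and of vector fields -/

/-- `f'` is, near `(ψ (x, f x)).1`, the smooth function onto whose graph the transformation `ψ`
maps the graph of `f` near `x`, that is, `f' = ψ · f` as germs. -/
def IsGermTransform (ψ : TotalSpace p q → TotalSpace p q) (f : IndepVar p → DepVar q)
    (x : IndepVar p) (f' : IndepVar p → DepVar q) : Prop :=
  ContDiffAt ℝ ∞ f' (ψ (x, f x)).1 ∧ ∀ᶠ y in 𝓝 x, f' (ψ (y, f y)).1 = (ψ (y, f y)).2

open Classical in
/-- The prolonged transformation
`pr^(n) ψ · (x, u^(n)) = (x', pr^(n) (ψ · f) (x'))`, `x' = (ψ (x, u)).1`, where `f` is the Taylor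
polynomial with jet `(x, u^(n))`; the fallback value is used only where `ψ · f` does not exist. -/
def prolongMap (n : ℕ) (ψ : TotalSpace p q → TotalSpace p q) (z : JetSpace p q n) :
    JetSpace p q n :=
  if h : ∃ f', IsGermTransform ψ (taylorFun z) z.1 f' then
    ((ψ z.base).1, prolongFun n h.choose (ψ z.base).1)
  else z

open Classical in
/-- The flow `Fl^v_ε (m)` on `M` of a vector field `v`: the value at time `ε` of the integral curve
in `M` that starts at `m`; the fallback value is used only where there is no such curve. -/
def flow (M : Set (TotalSpace p q)) (v : TotalSpace p q → TotalSpace p q) (ε : ℝ)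
    (m : TotalSpace p q) : TotalSpace p q :=
  if h : ∃ γ : ℝ → TotalSpace p q, γ 0 = m ∧ MapsTo γ (uIcc 0 ε) M ∧
      IsIntegralCurveOn γ (fun _ => v) (uIcc 0 ε) then
    h.choose ε
  else m

/-- The prolonged vector field `pr^(n) v |_z = d/dε|₀ pr^(n) (Fl^v_ε) (z)`. -/
def prolongField (n : ℕ) (M : Set (TotalSpace p q)) (v : TotalSpace p q → TotalSpace p q)
    (z : JetSpace p q n) : JetSpace p q n :=
  deriv (fun ε : ℝ => prolongMap n (flow M v ε) z) 0

/-- The total derivative `D_i P = ∂P/∂x^i + ∑_α u^α_i ∂P/∂u^α` of a function `P (x, u)`. -/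
def totalDeriv (hn : 1 ≤ n) (i : Fin p) (P : TotalSpace p q → ℝ) (z : JetSpace p q n) : ℝ :=
  fderiv ℝ P z.base (Pi.single i 1, z.first hn i)

/-- The total divergence `Div ξ = ∑_i D_i ξ^i` of a tuple of functions `ξ^i (x, u)`. -/
def totalDiv (hn : 1 ≤ n) (ξ : TotalSpace p q → IndepVar p) (z : JetSpace p q n) : ℝ :=
  ∑ i : Fin p, totalDeriv hn i (fun m => ξ m i) z

/-- The total Jacobian `J = (D_j Ξ^i)` of the `x`-component `Ξ` of a transformation `ψ`, at the
first order jet consisting of the point `m = (x, u)` and the first derivative `a` of `u`. -/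
def totalJacobian (ψ : TotalSpace p q → TotalSpace p q) (m : TotalSpace p q)
    (a : IndepVar p →L[ℝ] DepVar q) : IndepVar p →L[ℝ] IndepVar p :=
  (fderiv ℝ (fun m' => (ψ m').1) m).comp ((ContinuousLinearMap.id ℝ (IndepVar p)).prod a)

/-! ### Local transformation groups -/

/-- A local transformation group on `M ⊆ X × U`: a `d`-dimensional Lie group `G`, an open set
`domain ⊆ G × M` containing `{e} × M`, and a smooth map `(g, m) ↦ g · m` from it to `M`. The values
of `act` outside `domain` are irrelevant. -/
structure LocalTransformationGroup (d : ℕ) (G : Type*) [TopologicalSpace G]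
    [ChartedSpace (EuclideanSpace ℝ (Fin d)) G] [Group G] [LieGroup (𝓡 d) ∞ G]
    (M : Set (TotalSpace p q)) where
  domain : Set (G × TotalSpace p q)
  act : G → TotalSpace p q → TotalSpace p q
  isOpen_domain : IsOpen domain
  domain_subset : domain ⊆ univ ×ˢ M
  one_mem : ∀ m ∈ M, ((1 : G), m) ∈ domain
  act_mem : ∀ g m, (g, m) ∈ domain → act g m ∈ M
  smooth_act : ContMDiffOn ((𝓡 d).prod 𝓘(ℝ, TotalSpace p q)) 𝓘(ℝ, TotalSpace p q) ∞
    (fun y : G × TotalSpace p q => act y.1 y.2) domain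
  act_act : ∀ g h m, (h, m) ∈ domain → (g, act h m) ∈ domain → (g * h, m) ∈ domain →
    act g (act h m) = act (g * h) m
  one_act : ∀ m ∈ M, act 1 m = m
  inv_mem : ∀ g m, (g, m) ∈ domain → (g⁻¹, act g m) ∈ domain

namespace LocalTransformationGroup

variable {d : ℕ} {G : Type*} [TopologicalSpace G] [ChartedSpace (EuclideanSpace ℝ (Fin d)) G]
  [Group G] [LieGroup (𝓡 d) ∞ G] {M : Set (TotalSpace p q)}

/-- Connected local transformation groups: `M`, `G`, the domain, and all its sections
`{g | (g, m) ∈ domain}` are connected. -/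
def Connected (A : LocalTransformationGroup d G M) : Prop :=
  IsConnected M ∧ ConnectedSpace G ∧ IsConnected A.domain ∧
    ∀ m ∈ M, IsConnected {g : G | (g, m) ∈ A.domain}

/-- The infinitesimal generator `m ↦ T_e (g ↦ g · m) (w)` on `M` defined by `w ∈ T_e G`. -/
def generator (A : LocalTransformationGroup d G M) (w : GroupLieAlgebra (𝓡 d) G)
    (m : TotalSpace p q) : TotalSpace p q :=
  mfderiv (𝓡 d) 𝓘(ℝ, TotalSpace p q) (fun g : G => A.act g m) 1 w

/-- The set of all infinitesimal generators. -/
def generators (A : LocalTransformationGroup d G M) :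
    Set (TotalSpace p q → TotalSpace p q) :=
  range A.generator

/-- The group elements whose prolongation is defined at the first order jet `(m, a)`. Prolonging
`g` there requires that `g · m` is defined and that `J_g (m, a)` is invertible, and the prolonged
local transformation group, like every local transformation group, is taken to be connected: `g`
has to lie in the connected component of the identity. -/
def prolongedDomain (A : LocalTransformationGroup d G M) (m : TotalSpace p q)
    (a : IndepVar p →L[ℝ] DepVar q) : Set G :=
  connectedComponentIn
    {g : G | (g, m) ∈ A.domain ∧ (totalJacobian (A.act g) m a).det ≠ 0} 1

/-- `g · f` is well-defined and equal to the smooth function `f'` on the open set `Ω'`: the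
prolongation of `g` is defined along `f`, and `g` maps the graph of `f` over `Ω` onto the graph of
`f'` over `Ω'`. -/
def IsTransform (A : LocalTransformationGroup d G M) (g : G) (Ω : Set (IndepVar p))
    (f : IndepVar p → DepVar q) (Ω' : Set (IndepVar p)) (f' : IndepVar p → DepVar q) : Prop :=
  (∀ x ∈ Ω, g ∈ A.prolongedDomain (x, f x) (fderiv ℝ f x)) ∧
    IsOpen Ω' ∧ ContDiffOn ℝ ∞ f' Ω' ∧ A.act g '' (Ω.graphOn f) = Ω'.graphOn f'

/-- Variational symmetry groups of `∫_{Ω₀} L (x, u^(n)) dx`. That the two integrals agree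
includes that one of them exists if and only if the other one does. -/
def IsVariationalSymmetry (A : LocalTransformationGroup d G M) (Ω₀ : Set (IndepVar p))
    (L : JetSpace p q n → ℝ) : Prop :=
  ∀ (Ω : Set (IndepVar p)) (f : IndepVar p → DepVar q) (g : G)
    (Ω' : Set (IndepVar p)) (f' : IndepVar p → DepVar q),
    IsOpen Ω → IsConnected Ω → closure Ω ⊆ Ω₀ → ContDiffOn ℝ ∞ f Ω → Ω.graphOn f ⊆ M →
    A.IsTransform g Ω f Ω' f' → Ω' ⊆ Ω₀ →
    (IntegrableOn (fun x => L (x, prolongFun n f' x)) Ω' ↔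
      IntegrableOn (fun x => L (x, prolongFun n f x)) Ω) ∧
    ∫ x in Ω', L (x, prolongFun n f' x) = ∫ x in Ω, L (x, prolongFun n f x)

end LocalTransformationGroup

end VarSym

end

/-! Both conditions are equivalent to a pointwise one, `LocallyInvariant`: for each jet `z` over
`M`, `L (pr g · z) · det J_g (z) = L z` for all `g` near the identity. The left side is
`pullbackLagrangian`, the coefficient of the pulled back form `L dx`.

Integrals and pointwise invariance. If `g · f` is defined, `x ↦ Ξ_g (x, f x)` is an injective change
of variables with derivative `J_g`, so invariance of the integral says that `L (pr g · z) |det J_g|`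
and `L` have equal integrals along `f`. Every jet is the jet of a Taylor polynomial `f`, and for `g`
near `e` the transform of `f` exists over all small balls; shrinking the balls gives the pointwise
identity (`IsVariationalSymmetry.locallyInvariant`). Conversely, the cocycle identity
`eventually_pullbackLagrangian_mul` makes the pulled back Lagrangian and the sign of `det J_g`
locally constant in `g`. The prolonged domain is a connected component containing `e`, so the
identity holds on all of it with `det J_g > 0`, and the absolute value is harmless
(`LocallyInvariant.isVariationalSymmetry`).

Pointwise and infinitesimal invariance. In a chart of `G` at `e`, the derivative of the pulled back
Lagrangian at `e` in direction `w` is `pr v (L) + L Div ξ` for the generator `v` of `w`: the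
determinant contributes the trace of the derivative of `J_g`, which is `Div ξ` since mixed partials
commute. If this vanishes at every jet, the cocycle identity moves it from `e` to all nearby `g`, so
the function is constant near `e` (`locallyInvariant_iff`).

Two facts support this: jets of transformed functions depend only on jets (Faà di Bruno), and the
flow of a generator is the action along a curve in `G` with velocity `w` at `e`, an integral curve
of a right invariant field. -/

noncomputable section

namespace VarSym

/-! ### Equality of jets -/

section SameJet

variable {E F H : Type*} [NormedAddCommGroup E] [NormedSpace ℝ E]
  [NormedAddCommGroup F] [NormedSpace ℝ F] [NormedAddCommGroup H] [NormedSpace ℝ H]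

/-- Two functions have the same derivatives of order at most `n` at `x`. -/
def SameJet (n : ℕ) (f g : E → F) (x : E) : Prop :=
  ∀ k ≤ n, iteratedFDeriv ℝ k f x = iteratedFDeriv ℝ k g x

theorem SameJet.symm {n : ℕ} {f g : E → F} {x : E} (h : SameJet n f g x) : SameJet n g f x :=
  fun k hk => (h k hk).symm

theorem SameJet.trans {n : ℕ} {f g k : E → F} {x : E} (h : SameJet n f g x)
    (h' : SameJet n g k x) : SameJet n f k x :=
  fun i hi => (h i hi).trans (h' i hi)

theorem SameJet.of_eventuallyEq {n : ℕ} {f g : E → F} {x : E} (h : f =ᶠ[𝓝 x] g) :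
    SameJet n f g x :=
  fun _ _ => (h.iteratedFDeriv ℝ _).self_of_nhds

theorem SameJet.apply_eq {n : ℕ} {f g : E → F} {x : E} (h : SameJet n f g x) : f x = g x := by
  have := congrArg (fun m => m 0) (h 0 (Nat.zero_le n))
  simpa using this

theorem SameJet.fderiv_eq {n : ℕ} (hn : 1 ≤ n) {f g : E → F} {x : E} (h : SameJet n f g x) :
    fderiv ℝ f x = fderiv ℝ g x := by
  ext v
  have := congrArg (fun m => m fun _ => v) (h 1 hn)
  simpa [iteratedFDeriv_one_apply] using this

/-- Faà di Bruno: the `k`-th derivative of a composite is a sum over ordered partitions of `k`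
points, in which the number of blocks and all block sizes are at most `k`. -/
theorem SameJet.comp {n : ℕ} {f₁ f₂ : E → F} {g₁ g₂ : F → H} {x : E} (hf : SameJet n f₁ f₂ x)
    (hg : SameJet n g₁ g₂ (f₁ x)) (hf₁ : ContDiffAt ℝ n f₁ x) (hf₂ : ContDiffAt ℝ n f₂ x)
    (hg₁ : ContDiffAt ℝ n g₁ (f₁ x)) (hg₂ : ContDiffAt ℝ n g₂ (f₁ x)) :
    SameJet n (g₁ ∘ f₁) (g₂ ∘ f₂) x := by
  intro k hk
  have hk' : (k : ℕ∞ω) ≤ n := by exact_mod_cast hk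
  rw [iteratedFDeriv_comp hg₁ hf₁ hk', iteratedFDeriv_comp (hf.apply_eq ▸ hg₂) hf₂ hk',
    ← hf.apply_eq]
  simp only [FormalMultilinearSeries.taylorComp,
    FormalMultilinearSeries.compAlongOrderedFinpartition, ftaylorSeries]
  refine Finset.sum_congr rfl fun c _ => ?_
  rw [hg _ (c.length_le.trans hk)]
  congr 1
  funext m
  exact hf _ ((c.partSize_le m).trans hk)

theorem SameJet.prodMk {n : ℕ} {f₁ f₂ : E → F} {g₁ g₂ : E → H} {x : E} (hf : SameJet n f₁ f₂ x)
    (hg : SameJet n g₁ g₂ x) (hf₁ : ContDiffAt ℝ n f₁ x) (hf₂ : ContDiffAt ℝ n f₂ x)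
    (hg₁ : ContDiffAt ℝ n g₁ x) (hg₂ : ContDiffAt ℝ n g₂ x) :
    SameJet n (fun y => (f₁ y, g₁ y)) (fun y => (f₂ y, g₂ y)) x := by
  intro k hk
  have hk' : (k : ℕ∞ω) ≤ n := by exact_mod_cast hk
  rw [iteratedFDeriv_prodMk hf₁ hg₁ hk', iteratedFDeriv_prodMk hf₂ hg₂ hk', hf k hk, hg k hk]

theorem SameJet.refl (n : ℕ) (f : E → F) (x : E) : SameJet n f f x := fun _ _ => rfl

end SameJet

variable {p q n : ℕ}

/-! ### Partial derivatives -/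

theorem natCast_ne_infty (k : ℕ) : (k : ℕ∞ω) ≠ ∞ := fun h =>
  ENat.natCast_ne_top k (WithTop.coe_injective h)

/-- Frees the order `k` from being syntactically the length of a list. -/
theorem partialDeriv_eq_iteratedFDeriv {l : List (Fin p)} {k : ℕ} (h : l.length = k)
    (v : Fin k → Fin p) (hv : ∀ i, l.get i = v (Fin.cast h i)) (f : IndepVar p → DepVar q)
    (x : IndepVar p) :
    partialDeriv l f x = iteratedFDeriv ℝ k f x fun i => Pi.single (v i) 1 := by
  subst h
  simp only [partialDeriv, hv]
  rfl

theorem partialDeriv_nil (f : IndepVar p → DepVar q) (x : IndepVar p) :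
    partialDeriv [] f x = f x := by
  simp [partialDeriv]

theorem partialDeriv_singleton (i : Fin p) (f : IndepVar p → DepVar q) (x : IndepVar p) :
    partialDeriv [i] f x = fderiv ℝ f x (Pi.single i 1) := by
  rw [partialDeriv_eq_iteratedFDeriv (k := 1) rfl (fun _ => i) (by simp), iteratedFDeriv_one_apply]

theorem partialDeriv_cons (i : Fin p) (l : List (Fin p)) {f : IndepVar p → DepVar q}
    {x : IndepVar p} (hf : ContDiffAt ℝ (1 + l.length : ℕ) f x) :
    partialDeriv (i :: l) f x = fderiv ℝ (partialDeriv l f) x (Pi.single i 1) := by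
  have hd : DifferentiableAt ℝ (iteratedFDeriv ℝ l.length f) x :=
    (hf.iteratedFDeriv_right (m := 1) (by push_cast; rfl)).differentiableAt one_ne_zero
  unfold partialDeriv
  rw [fderiv_continuousMultilinear_apply_const_apply hd]
  exact iteratedFDeriv_succ_apply_left (n := l.length) _

theorem contDiffAt_partialDeriv (l : List (Fin p)) {f : IndepVar p → DepVar q} {x : IndepVar p}
    {m k : ℕ∞ω} (hf : ContDiffAt ℝ k f x) (hk : m + l.length ≤ k) :
    ContDiffAt ℝ m (partialDeriv l f) x :=
  (ContinuousMultilinearMap.apply ℝ (fun _ => IndepVar p) (DepVar q)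
    (fun k => Pi.single (l.get k) 1)).contDiff.comp_contDiffAt
    x (hf.iteratedFDeriv_right hk)

/-- Schwarz's theorem, applied to adjacent transpositions. It makes the sorted listing used in
`prolongFun` immaterial. The point varies in the induction because prepending an index
differentiates an identity that must hold near `x`. -/
theorem partialDeriv_perm {l₁ l₂ : List (Fin p)} (h : l₁.Perm l₂) {f : IndepVar p → DepVar q}
    {x : IndepVar p} (hf : ContDiffAt ℝ l₁.length f x) :
    partialDeriv l₁ f x = partialDeriv l₂ f x := by
  induction h generalizing x with
  | nil => rfl
  | @cons i l₁ l₂ h ih =>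
    have hf' : ContDiffAt ℝ (1 + l₁.length : ℕ) f x := by
      rwa [List.length_cons, add_comm] at hf
    rw [partialDeriv_cons i l₁ hf', partialDeriv_cons i l₂ (h.length_eq ▸ hf')]
    have : partialDeriv l₁ f =ᶠ[𝓝 x] partialDeriv l₂ f := by
      filter_upwards [hf'.eventually (natCast_ne_infty _)] with y hy
      exact ih (hy.of_le (by push_cast; exact le_add_self))
    rw [this.fderiv_eq]
  | swap i j l =>
    have hf' : ContDiffAt ℝ (2 + l.length : ℕ) f x := by
      rwa [List.length_cons, List.length_cons, add_assoc, add_comm] at hf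
    have hg : ContDiffAt ℝ 2 (partialDeriv l f) x :=
      contDiffAt_partialDeriv l hf' (by push_cast; rfl)
    have hsymm := hg.isSymmSndFDerivAt (by simp)
    have hev : ∀ i : Fin p, partialDeriv (i :: l) f =ᶠ[𝓝 x]
        fun y => fderiv ℝ (partialDeriv l f) y (Pi.single i 1) := fun i => by
      filter_upwards [hf'.eventually (natCast_ne_infty _)] with y hy
      exact partialDeriv_cons i l (hy.of_le (by norm_cast; lia))
    have hd : DifferentiableAt ℝ (fderiv ℝ (partialDeriv l f)) x :=
      (hg.fderiv_right (m := 1) (by norm_num)).differentiableAt one_ne_zero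
    have key : ∀ i j : Fin p, partialDeriv (i :: j :: l) f x =
        fderiv ℝ (fderiv ℝ (partialDeriv l f)) x (Pi.single i 1) (Pi.single j 1) := fun i j => by
      rw [partialDeriv_cons i (j :: l) (hf'.of_le (by norm_cast; simp; lia)),
        (hev j).fderiv_eq, fderiv_clm_apply hd (by fun_prop)]
      simp
    rw [key, key]
    exact hsymm _ _
  | trans h₁ _ ih₁ ih₂ => exact (ih₁ hf).trans (ih₂ (h₁.length_eq ▸ hf))

theorem contDiffAt_prolongFun {f : IndepVar p → DepVar q} {x : IndepVar p}
    (hf : ContDiffAt ℝ ∞ f x) : ContDiffAt ℝ ∞ (prolongFun n f) x :=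
  contDiffAt_pi.2 fun _ => contDiffAt_partialDeriv _ hf (by exact_mod_cast le_top)

/-- A multilinear map is determined by its values on basis vectors, and each such value of a
derivative is, up to the order of the indices, a jet coordinate. -/
theorem sameJet_of_prolongFun_eq {f g : IndepVar p → DepVar q} {x : IndepVar p}
    (hf : ContDiffAt ℝ ∞ f x) (hg : ContDiffAt ℝ ∞ g x)
    (h : prolongFun n f x = prolongFun n g x) : SameJet n f g x := by
  intro k hk
  apply ContinuousMultilinearMap.toMultilinearMap_injective
  refine Module.Basis.ext_multilinear (fun _ => Pi.basisFun ℝ (Fin p)) fun v => ?_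
  simp only [Pi.basisFun_apply, ContinuousMultilinearMap.coe_coe]
  let s : Sym (Fin p) k := ⟨(List.ofFn v : Multiset (Fin p)), by simp⟩
  have hs : ((s : Multiset (Fin p)).sort (· ≤ ·)).Perm (List.ofFn v) := by
    rw [← Multiset.coe_eq_coe, Multiset.sort_eq]
    rfl
  have key : ∀ {f : IndepVar p → DepVar q}, ContDiffAt ℝ ∞ f x →
      prolongFun n f x ⟨⟨k, Nat.lt_succ_of_le hk⟩, s⟩ =
        iteratedFDeriv ℝ k f x fun i => Pi.single (v i) 1 := by
    intro f hf
    have : prolongFun n f x ⟨⟨k, Nat.lt_succ_of_le hk⟩, s⟩ = partialDeriv (List.ofFn v) f x :=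
      partialDeriv_perm hs (hf.of_le (by exact_mod_cast le_top))
    rw [this, partialDeriv_eq_iteratedFDeriv (k := k) (by simp) v (by intro i; simp; rfl)]
  rw [← key hf, ← key hg, h]

theorem SameJet.prolongFun_eq {f g : IndepVar p → DepVar q} {x : IndepVar p}
    (h : SameJet n f g x) : prolongFun n f x = prolongFun n g x := by
  funext J
  have : ((J.2 : Multiset (Fin p)).sort (· ≤ ·)).length ≤ n := by
    rw [Multiset.length_sort, Sym.card_coe]
    exact Nat.le_of_lt_succ J.1.2
  simp only [prolongFun, partialDeriv, h _ this]

end VarSym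

namespace VarSym

variable {p q n : ℕ}

/-! ### Taylor polynomials -/

/-- The monomial `(y - x)^κ / κ!`. -/
def taylorMonomial (x : IndepVar p) (κ : Fin p → ℕ) (y : IndepVar p) : ℝ :=
  ∏ j, (y j - x j) ^ κ j / ((κ j).factorial : ℝ)

theorem contDiff_taylorMonomial (x : IndepVar p) (κ : Fin p → ℕ) :
    ContDiff ℝ ∞ (taylorMonomial x κ) := by
  unfold taylorMonomial
  fun_prop

theorem taylorMonomial_self (x : IndepVar p) (κ : Fin p → ℕ) :
    taylorMonomial x κ x = if κ = 0 then 1 else 0 := by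
  split_ifs with h
  · simp [taylorMonomial, h]
  · obtain ⟨j, hj⟩ := Function.ne_iff.1 h
    exact Finset.prod_eq_zero (Finset.mem_univ j) (by simp [zero_pow hj])

/-- Thanks to the division by `κ!`, differentiation just lowers an exponent. The case `κ i = 0` is
separate because `κ i - 1` is truncated there. -/
theorem fderiv_taylorMonomial (x : IndepVar p) (κ : Fin p → ℕ) (y : IndepVar p) (i : Fin p) :
    fderiv ℝ (taylorMonomial x κ) y (Pi.single i 1) =
      if κ i = 0 then 0 else taylorMonomial x (Function.update κ i (κ i - 1)) y := by
  classical
  have h (j : Fin p) : HasFDerivAt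
      (fun y : IndepVar p => (y j - x j) ^ κ j / ((κ j).factorial : ℝ))
      ((((κ j : ℝ) * (y j - x j) ^ (κ j - 1)) / ((κ j).factorial : ℝ)) •
        ContinuousLinearMap.proj (R := ℝ) (φ := fun _ : Fin p => ℝ) j) y := by
    have h1 : HasFDerivAt (fun y : IndepVar p => y j - x j)
        (ContinuousLinearMap.proj (R := ℝ) (φ := fun _ : Fin p => ℝ) j) y :=
      (hasFDerivAt_apply j y).sub_const _
    have h2 : HasDerivAt (fun t : ℝ => t ^ κ j / ((κ j).factorial : ℝ))
        (((κ j : ℝ) * (y j - x j) ^ (κ j - 1)) / ((κ j).factorial : ℝ)) (y j - x j) :=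
      (hasDerivAt_pow (κ j) (y j - x j)).div_const _
    exact h2.comp_hasFDerivAt y h1
  have := (HasFDerivAt.finsetProd (u := Finset.univ) fun j _ => h j).fderiv
  unfold taylorMonomial
  rw [this]
  simp only [_root_.sum_apply, _root_.smul_apply,
    ContinuousLinearMap.proj_apply, smul_eq_mul]
  rw [Finset.sum_eq_single i (fun j _ hj => by simp [hj]) (by simp)]
  split_ifs with hi
  · simp [hi]
  · rw [← Finset.mul_prod_erase Finset.univ _ (Finset.mem_univ i)]
    rw [Finset.prod_congr (s₁ := Finset.univ.erase i) rfl
      (f := fun j => (y j - x j) ^ Function.update κ i (κ i - 1) j /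
        ((Function.update κ i (κ i - 1) j).factorial : ℝ))
      (fun j hj => by rw [Function.update_of_ne (Finset.ne_of_mem_erase hj)])]
    obtain ⟨c, hc⟩ := Nat.exists_eq_succ_of_ne_zero hi
    simp only [hc, Function.update_self, Nat.succ_eq_add_one, Nat.add_sub_cancel, Pi.single_eq_same,
      mul_one, Nat.factorial_succ]
    rw [mul_comm]
    congr 1
    push_cast
    have : (c.factorial : ℝ) ≠ 0 := by positivity
    have : (c : ℝ) + 1 ≠ 0 := by positivity
    field_simp

theorem partialDeriv_taylorMonomial_smul (x : IndepVar p) (κ : Fin p → ℕ) (c : DepVar q)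
    (l : List (Fin p)) (y : IndepVar p) :
    partialDeriv l (fun y => taylorMonomial x κ y • c) y =
      if ∀ j, l.count j ≤ κ j then taylorMonomial x (fun j => κ j - l.count j) y • c else 0 := by
  induction l generalizing y with
  | nil => simp [partialDeriv_nil]
  | cons i l ih =>
    have hc : ContDiff ℝ ∞ fun y => taylorMonomial x κ y • c :=
      (contDiff_taylorMonomial x κ).smul contDiff_const
    rw [partialDeriv_cons i l (hc.contDiffAt.of_le (by exact_mod_cast le_top)), funext ih]
    by_cases h : ∀ j, l.count j ≤ κ j
    · simp only [h, implies_true, if_true]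
      rw [fderiv_smul_const
        ((contDiff_taylorMonomial x _).differentiable (by simp)).differentiableAt]
      rw [ContinuousLinearMap.smulRight_apply, fderiv_taylorMonomial]
      by_cases hi : κ i - l.count i = 0
      · have : ¬ ∀ j, (i :: l).count j ≤ κ j := fun H => by
          have := H i
          rw [List.count_cons_self] at this
          lia
        simp [hi, this]
      · have : ∀ j, (i :: l).count j ≤ κ j := fun j => by
          rw [List.count_cons]
          have := h j
          split_ifs with hij
          · have hij : i = j := by simpa using hij
            subst hij
            lia
          · lia
        rw [if_neg hi, if_pos this]
        congr 2
        funext j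
        rw [List.count_cons, Function.update_apply]
        split_ifs <;> simp_all
        lia
    · have : ¬ ∀ j, (i :: l).count j ≤ κ j := fun H => h fun j =>
        (List.count_le_count_cons).trans (H j)
      simp [h, this]

theorem taylorFun_eq (z : JetSpace p q n) :
    taylorFun z = fun y => ∑ J : MultiIndex p n,
      taylorMonomial z.1 (fun j => (J.2 : Multiset (Fin p)).count j) y • z.2 J := by
  funext y
  unfold taylorFun taylorMonomial
  refine Finset.sum_congr rfl fun J _ => ?_
  rw [Finset.prod_div_distrib, Finset.prod_multiset_map_count]
  congr 2
  · refine Finset.prod_subset (Finset.subset_univ _) fun j _ hj => ?_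
    rw [Multiset.count_eq_zero_of_notMem (by simpa using hj), pow_zero]
  · push_cast
    rfl

theorem contDiff_taylorFun (z : JetSpace p q n) : ContDiff ℝ ∞ (taylorFun z) := by
  rw [taylorFun_eq]
  exact ContDiff.sum fun J _ => (contDiff_taylorMonomial _ _).smul contDiff_const

theorem MultiIndex.ext {J K : MultiIndex p n}
    (h : (J.2 : Multiset (Fin p)) = (K.2 : Multiset (Fin p))) : J = K := by
  obtain ⟨⟨j, hj⟩, s⟩ := J
  obtain ⟨⟨k, hk⟩, t⟩ := K
  have hjk : j = k := by
    have := congrArg Multiset.card h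
    rwa [Sym.card_coe, Sym.card_coe] at this
  subst hjk
  have : s = t := Subtype.ext h
  rw [this]

/-- Applying `∂_J` to the monomial of `K` gives zero or a monomial of exponent `K - J`; at the
centre only exponent zero survives, that is, `K = J`. -/
theorem prolongFun_taylorFun (z : JetSpace p q n) : prolongFun n (taylorFun z) z.1 = z.2 := by
  classical
  funext J
  set l := (J.2 : Multiset (Fin p)).sort (· ≤ ·) with hl
  have hlJ : ∀ j, l.count j = (J.2 : Multiset (Fin p)).count j := fun j => by
    conv_rhs => rw [← Multiset.sort_eq (J.2 : Multiset (Fin p)) (· ≤ ·)]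
    rw [Multiset.coe_count]
  have hsum : partialDeriv l (taylorFun z) z.1 = ∑ K : MultiIndex p n, partialDeriv l (fun y =>
      taylorMonomial z.1 (fun j => (K.2 : Multiset (Fin p)).count j) y • z.2 K) z.1 := by
    rw [taylorFun_eq]
    unfold partialDeriv
    rw [iteratedFDeriv_fun_sum_apply (f := fun (K : MultiIndex p n) y =>
      taylorMonomial z.1 (fun j => (K.2 : Multiset (Fin p)).count j) y • z.2 K) (fun K _ =>
      (((contDiff_taylorMonomial _ _).smul contDiff_const).contDiffAt.of_le
        (by exact_mod_cast le_top)))]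
    simp
  change partialDeriv l (taylorFun z) z.1 = _
  rw [hsum, Finset.sum_eq_single J]
  · rw [partialDeriv_taylorMonomial_smul, if_pos fun j => (hlJ j).le, taylorMonomial_self, if_pos,
      one_smul]
    funext j
    simp [hlJ]
  · intro K _ hKJ
    rw [partialDeriv_taylorMonomial_smul]
    split_ifs with h
    · rw [taylorMonomial_self, if_neg, zero_smul]
      -- Truncated differences that vanish give only `K ≤ J`; the branch condition `h` supplies `J ≤
      -- K`.
      intro h0
      refine hKJ (MultiIndex.ext (Multiset.ext.2 fun j => ?_))
      have h1 := congrFun h0 j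
      have h2 := h j
      have h3 := hlJ j
      simp only [Pi.zero_apply] at h1
      lia
    · rfl
  · simp

theorem prolongFun_nil (f : IndepVar p → DepVar q) (x : IndepVar p) :
    prolongFun n f x ⟨0, Sym.nil⟩ = f x := by
  change partialDeriv (Multiset.sort (0 : Multiset (Fin p)) (· ≤ ·)) f x = f x
  rw [Multiset.sort_zero, partialDeriv_nil]

theorem taylorFun_self (z : JetSpace p q n) : taylorFun z z.1 = z.2 ⟨0, Sym.nil⟩ := by
  rw [← prolongFun_nil (n := n) (taylorFun z) z.1, prolongFun_taylorFun]

theorem base_eq (z : JetSpace p q n) : z.base = (z.1, taylorFun z z.1) := by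
  rw [taylorFun_self]
  rfl

theorem base_prolongFun (f : IndepVar p → DepVar q) (x : IndepVar p) :
    JetSpace.base ((x, prolongFun n f x) : JetSpace p q n) = (x, f x) := by
  simp [JetSpace.base, prolongFun_nil]

theorem first_prolongFun (hn : 1 ≤ n) (f : IndepVar p → DepVar q) (x : IndepVar p) (i : Fin p) :
    JetSpace.first hn ((x, prolongFun n f x) : JetSpace p q n) i =
      fderiv ℝ f x (Pi.single i 1) := by
  rw [← partialDeriv_singleton]
  change partialDeriv (Multiset.sort ({i} : Multiset (Fin p)) (· ≤ ·)) f x = _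
  rw [Multiset.sort_singleton]

theorem fderiv_taylorFun (hn : 1 ≤ n) (z : JetSpace p q n) (i : Fin p) :
    fderiv ℝ (taylorFun z) z.1 (Pi.single i 1) = z.first hn i := by
  rw [← first_prolongFun hn, prolongFun_taylorFun]

end VarSym

namespace VarSym

/-! ### The inverse function theorem -/

section Inverse

variable {V : Type*} [NormedAddCommGroup V] [NormedSpace ℝ V] [FiniteDimensional ℝ V]

theorem isInvertible_of_injective {D : V →L[ℝ] V} (hD : Function.Injective D) :
    D.IsInvertible :=
  ⟨(LinearEquiv.ofInjectiveEndo (D : V →ₗ[ℝ] V) hD).toContinuousLinearEquiv, by ext; rfl⟩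

theorem isInvertible_of_det_ne_zero {D : V →L[ℝ] V} (hD : D.det ≠ 0) : D.IsInvertible :=
  ⟨D.toContinuousLinearEquivOfDetNeZero hD, by ext; rfl⟩

/-- The source is cut down to points where the derivative is still invertible, so that the inverse
is smooth on the whole target and not only at the image of `x`. -/
theorem exists_openPartialHomeomorph {H : V → V} {O : Set V} (hO : IsOpen O)
    (hH : ContDiffOn ℝ ∞ H O) {x : V} (hx : x ∈ O) (hD : (fderiv ℝ H x).IsInvertible) :
    ∃ e : OpenPartialHomeomorph V V, x ∈ e.source ∧ e.source ⊆ O ∧ ⇑e = H ∧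
      ContDiffOn ℝ ∞ e.symm e.target := by
  have : CompleteSpace V := FiniteDimensional.complete ℝ V
  have hHx : ContDiffAt ℝ ∞ H x := hH.contDiffAt (hO.mem_nhds hx)
  obtain ⟨D, hD⟩ := hD
  have hDx : HasFDerivAt H (D : V →L[ℝ] V) x := hD ▸ (hHx.differentiableAt (by simp)).hasFDerivAt
  have hinv : ∀ᶠ y in 𝓝 x, (fderiv ℝ H y).IsInvertible := by
    have hc : ContinuousAt (fderiv ℝ H) x :=
      (hHx.fderiv_right (m := 0) (by simp)).continuousAt
    exact hc.eventually (ContinuousLinearEquiv.isOpen.mem_nhds ⟨D, hD⟩)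
  obtain ⟨s, hs, hso, hxs⟩ := eventually_nhds_iff.1 hinv
  let e₀ := hHx.toOpenPartialHomeomorph H hDx (by simp)
  have he₀ : ⇑e₀ = H := rfl
  refine ⟨e₀.restrOpen (O ∩ s) (hO.inter hso),
    ⟨hHx.mem_toOpenPartialHomeomorph_source hDx (by simp), hx, hxs⟩, fun y hy => hy.2.1, rfl, ?_⟩
  intro y hy
  refine ContDiffAt.contDiffWithinAt ?_
  have hy' := (e₀.restrOpen (O ∩ s) (hO.inter hso)).map_target hy
  set y' := (e₀.restrOpen (O ∩ s) (hO.inter hso)).symm y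
  obtain ⟨D', hD'⟩ := hs y' hy'.2.2
  have hy'H : ContDiffAt ℝ ∞ H y' := hH.contDiffAt (hO.mem_nhds hy'.2.1)
  refine OpenPartialHomeomorph.contDiffAt_symm _ (f₀' := D') hy ?_ hy'H
  rw [hD']
  exact (hy'H.differentiableAt (by simp)).hasFDerivAt

/-- A local inverse at a point where the derivative is invertible. -/
theorem exists_contDiffAt_inverse {H : V → V} {x : V} (hH : ContDiffAt ℝ ∞ H x)
    (hD : (fderiv ℝ H x).IsInvertible) :
    ∃ r : V → V, r (H x) = x ∧ ContDiffAt ℝ ∞ r (H x) ∧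
      (∀ᶠ y in 𝓝 x, r (H y) = y) ∧ ∀ᶠ y in 𝓝 (H x), H (r y) = y := by
  have : CompleteSpace V := FiniteDimensional.complete ℝ V
  obtain ⟨D, hD⟩ := hD
  have hDx : HasFDerivAt H (D : V →L[ℝ] V) x := hD ▸ (hH.differentiableAt (by simp)).hasFDerivAt
  have hs := hH.hasStrictFDerivAt' hDx (by simp)
  exact ⟨hH.localInverse hDx (by simp), hH.localInverse_apply_image hDx (by simp),
    hH.to_localInverse hDx (by simp), hs.eventually_left_inverse, hs.eventually_right_inverse⟩

end Inverse

variable {p q n : ℕ} {ψ : TotalSpace p q → TotalSpace p q} {x : IndepVar p}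
  {f f' : IndepVar p → DepVar q}

/-! ### Transformation of germs -/

/-- The chain rule identifies the total Jacobian with the derivative of the change of independent
variables induced by `ψ` along the graph of `f`. -/
theorem hasFDerivAt_fst_graph (hψ : DifferentiableAt ℝ ψ (x, f x)) (hf : DifferentiableAt ℝ f x) :
    HasFDerivAt (fun y => (ψ (y, f y)).1) (totalJacobian ψ (x, f x) (fderiv ℝ f x)) x := by
  have h1 : HasFDerivAt (fun y => (y, f y))
      ((ContinuousLinearMap.id ℝ (IndepVar p)).prod (fderiv ℝ f x)) x :=
    (hasFDerivAt_id x).prodMk hf.hasFDerivAt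
  have h2 : HasFDerivAt (fun m => (ψ m).1) (fderiv ℝ (fun m => (ψ m).1) (x, f x)) (x, f x) :=
    hψ.fst.hasFDerivAt
  exact HasFDerivAt.comp (g := fun m => (ψ m).1) (f := fun y => (y, f y)) x h2 h1

theorem contDiffAt_graph (hψ : ContDiffAt ℝ ∞ ψ (x, f x)) (hf : ContDiffAt ℝ ∞ f x) :
    ContDiffAt ℝ ∞ (fun y => ψ (y, f y)) x :=
  ContDiffAt.comp x hψ (contDiffAt_id.prodMk hf)

theorem exists_inverse_fst_graph (hψ : ContDiffAt ℝ ∞ ψ (x, f x)) (hf : ContDiffAt ℝ ∞ f x)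
    (hdet : (totalJacobian ψ (x, f x) (fderiv ℝ f x)).det ≠ 0) :
    ∃ r : IndepVar p → IndepVar p, r (ψ (x, f x)).1 = x ∧ ContDiffAt ℝ ∞ r (ψ (x, f x)).1 ∧
      (∀ᶠ y in 𝓝 x, r (ψ (y, f y)).1 = y) ∧
      ∀ᶠ y in 𝓝 (ψ (x, f x)).1, (ψ (r y, f (r y))).1 = y := by
  refine exists_contDiffAt_inverse (H := fun y => (ψ (y, f y)).1) (contDiffAt_graph hψ hf).fst ?_
  rw [(hasFDerivAt_fst_graph (hψ.differentiableAt (by simp))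
    (hf.differentiableAt (by simp))).fderiv]
  exact isInvertible_of_det_ne_zero hdet

/-- Invert the change of independent variables by some `r`; the transform is then `y ↦ Φ (r y, f (r
y))`. -/
theorem exists_isGermTransform (hψ : ContDiffAt ℝ ∞ ψ (x, f x)) (hf : ContDiffAt ℝ ∞ f x)
    (hdet : (totalJacobian ψ (x, f x) (fderiv ℝ f x)).det ≠ 0) :
    ∃ f', IsGermTransform ψ f x f' := by
  obtain ⟨r, hrx, hr, hleft, -⟩ := exists_inverse_fst_graph hψ hf hdet
  refine ⟨fun y => (ψ (r y, f (r y))).2, ?_, ?_⟩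
  · have h1 : ContDiffAt ℝ ∞ (fun y => ψ (y, f y)) (r (ψ (x, f x)).1) := by
      rw [hrx]
      exact contDiffAt_graph hψ hf
    exact (ContDiffAt.comp _ h1 hr).snd
  · filter_upwards [hleft] with y hy
    simp only [hy]

/-- Germs with the same jet are transformed into germs with the same jet. -/
theorem IsGermTransform.sameJet {f₁ f₂ f₁' f₂' : IndepVar p → DepVar q}
    (h₁ : IsGermTransform ψ f₁ x f₁') (h₂ : IsGermTransform ψ f₂ x f₂')
    (hf : SameJet n f₁ f₂ x) (hψ : ContDiffAt ℝ ∞ ψ (x, f₁ x)) (hf₁ : ContDiffAt ℝ ∞ f₁ x)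
    (hf₂ : ContDiffAt ℝ ∞ f₂ x)
    (hdet : (totalJacobian ψ (x, f₁ x) (fderiv ℝ f₁ x)).det ≠ 0) :
    SameJet n f₁' f₂' (ψ (x, f₁ x)).1 := by
  have hle : (n : ℕ∞ω) ≤ ∞ := by exact_mod_cast le_top
  have hψ₂ : ContDiffAt ℝ ∞ ψ (x, f₂ x) := hf.apply_eq ▸ hψ
  have hg₁ := contDiffAt_graph hψ hf₁
  have hg₂ := contDiffAt_graph hψ₂ hf₂
  have hψf : SameJet n (fun y => ψ (y, f₁ y)) (fun y => ψ (y, f₂ y)) x :=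
    SameJet.comp (g₁ := ψ) (g₂ := ψ) (f₁ := fun y => (y, f₁ y)) (f₂ := fun y => (y, f₂ y))
      ((SameJet.refl n _ x).prodMk hf contDiffAt_id contDiffAt_id (hf₁.of_le hle) (hf₂.of_le hle))
      (SameJet.refl _ _ _) (contDiffAt_id.prodMk (hf₁.of_le hle))
      (contDiffAt_id.prodMk (hf₂.of_le hle)) (hψ.of_le hle) (hψ.of_le hle)
  have ha : SameJet n (fun y => (ψ (y, f₁ y)).1) (fun y => (ψ (y, f₂ y)).1) x :=
    SameJet.comp (g₁ := Prod.fst) (g₂ := Prod.fst) hψf (SameJet.refl _ _ _) (hg₁.of_le hle)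
      (hg₂.of_le hle) contDiffAt_fst contDiffAt_fst
  have hb : SameJet n (fun y => (ψ (y, f₁ y)).2) (fun y => (ψ (y, f₂ y)).2) x :=
    SameJet.comp (g₁ := Prod.snd) (g₂ := Prod.snd) hψf (SameJet.refl _ _ _) (hg₁.of_le hle)
      (hg₂.of_le hle) contDiffAt_snd contDiffAt_snd
  have hx : (ψ (x, f₂ x)).1 = (ψ (x, f₁ x)).1 := by rw [hf.apply_eq]
  have h₁c := h₁.1.of_le hle
  have h₂c : ContDiffAt ℝ n f₂' (ψ (x, f₁ x)).1 := hx ▸ h₂.1.of_le hle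
  -- Writing `a_i y = (ψ (y, f_i y)).1`, the relation `f_i' ∘ a_i = Φ (·, f_i)` makes the jets of
  -- `f₁' ∘ a₁` and `f₂' ∘ a₂` agree; then `a₂` is exchanged for `a₁`.
  have hcomp : SameJet n (f₁' ∘ fun y => (ψ (y, f₁ y)).1) (f₂' ∘ fun y => (ψ (y, f₁ y)).1) x := by
    refine (SameJet.of_eventuallyEq h₁.2).trans (hb.trans
      ((SameJet.of_eventuallyEq h₂.2).symm.trans ?_))
    exact SameJet.comp (f₁ := fun y => (ψ (y, f₂ y)).1) (g₁ := f₂') (g₂ := f₂') ha.symm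
      (SameJet.refl _ _ _) (hg₂.fst.of_le hle) (hg₁.fst.of_le hle) (h₂.1.of_le hle)
      (h₂.1.of_le hle)
  -- Composition with a local inverse of `a₁` cancels it on both sides.
  obtain ⟨r, hrx, hr, -, hright⟩ := exists_inverse_fst_graph hψ hf₁ hdet
  have hrn := hr.of_le hle
  have e : ∀ g : IndepVar p → DepVar q,
      ((g ∘ fun y => (ψ (y, f₁ y)).1) ∘ r) =ᶠ[𝓝 (ψ (x, f₁ x)).1] g := fun g => by
    filter_upwards [hright] with y hy
    simp only [Function.comp_apply, hy]
  refine (SameJet.of_eventuallyEq (e f₁')).symm.trans (SameJet.trans ?_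
    (SameJet.of_eventuallyEq (e f₂')))
  have hc₁ : ContDiffAt ℝ n (f₁' ∘ fun y => (ψ (y, f₁ y)).1) x :=
    ContDiffAt.comp x h₁c (hg₁.fst.of_le hle)
  have hc₂ : ContDiffAt ℝ n (f₂' ∘ fun y => (ψ (y, f₁ y)).1) x :=
    ContDiffAt.comp x h₂c (hg₁.fst.of_le hle)
  rw [← hrx] at hcomp hc₁ hc₂
  exact SameJet.comp (SameJet.refl _ _ _) hcomp hrn hrn hc₁ hc₂

theorem sameJet_taylorFun (hf : ContDiffAt ℝ ∞ f x) :
    SameJet n (taylorFun ((x, prolongFun n f x) : JetSpace p q n)) f x :=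
  sameJet_of_prolongFun_eq (contDiff_taylorFun _).contDiffAt hf
    (prolongFun_taylorFun ((x, prolongFun n f x) : JetSpace p q n))

/-- The prolonged transformation can be computed with any function representing the jet. -/
theorem prolongMap_eq (hn : 1 ≤ n) (h : IsGermTransform ψ f x f')
    (hψ : ContDiffAt ℝ ∞ ψ (x, f x)) (hf : ContDiffAt ℝ ∞ f x)
    (hdet : (totalJacobian ψ (x, f x) (fderiv ℝ f x)).det ≠ 0) :
    prolongMap n ψ (x, prolongFun n f x) =
      ((ψ (x, f x)).1, prolongFun n f' (ψ (x, f x)).1) := by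
  have hj := sameJet_taylorFun (n := n) hf
  have hex : ∃ f', IsGermTransform ψ (taylorFun ((x, prolongFun n f x) : JetSpace p q n)) x f' := by
    refine exists_isGermTransform ?_ (contDiff_taylorFun _).contDiffAt ?_
    · rwa [hj.apply_eq]
    · rwa [hj.apply_eq, hj.fderiv_eq hn]
  unfold prolongMap
  rw [dif_pos hex, base_prolongFun]
  have := (h.sameJet hex.choose_spec hj.symm hψ hf (contDiff_taylorFun _).contDiffAt
    hdet).prolongFun_eq
  rw [this]

theorem IsGermTransform.congr {ψ₁ ψ₂ : TotalSpace p q → TotalSpace p q}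
    (hψ : ψ₁ =ᶠ[𝓝 (x, f x)] ψ₂) (hf : ContinuousAt f x) (h : IsGermTransform ψ₁ f x f') :
    IsGermTransform ψ₂ f x f' := by
  refine ⟨hψ.self_of_nhds ▸ h.1, ?_⟩
  filter_upwards [h.2, (continuousAt_id.prodMk hf).eventually hψ] with y hy hy'
  have hy' : ψ₁ (y, f y) = ψ₂ (y, f y) := hy'
  rw [← hy', hy]

/-- The predicates on `f'` are equal, not merely equivalent in effect, so the choices inside
`prolongMap` coincide as well. -/
theorem prolongMap_congr {ψ₁ ψ₂ : TotalSpace p q → TotalSpace p q} {z : JetSpace p q n}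
    (hψ : ψ₁ =ᶠ[𝓝 z.base] ψ₂) : prolongMap n ψ₁ z = prolongMap n ψ₂ z := by
  have hc := (contDiff_taylorFun z).continuous.continuousAt (x := z.1)
  have h : (fun f' => IsGermTransform ψ₁ (taylorFun z) z.1 f') =
      fun f' => IsGermTransform ψ₂ (taylorFun z) z.1 f' := by
    rw [base_eq] at hψ
    exact funext fun f' => propext ⟨fun h => h.congr hψ hc, fun h => h.congr hψ.symm hc⟩
  simp only [prolongMap, hψ.self_of_nhds]
  congr! 1
  · simp only [h]
  · simp only [h]

end VarSym

namespace VarSym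

/-! ### The derivative of the determinant -/

section Det

variable {p : ℕ}

theorem det_eq_matrix_det (D : IndepVar p →L[ℝ] IndepVar p) :
    D.det = Matrix.det (Matrix.of fun i j => D (Pi.single j 1) i) := by
  rw [ContinuousLinearMap.det, ← LinearMap.det_toMatrix']
  rfl

theorem contDiff_det : ContDiff ℝ ∞ fun D : IndepVar p →L[ℝ] IndepVar p => D.det := by
  simp only [det_eq_matrix_det, Matrix.det_apply, Matrix.of_apply]
  refine ContDiff.sum fun σ _ => ContDiff.const_smul _ (contDiff_prod fun i _ => ?_)
  have : ContDiff ℝ ∞ fun D : IndepVar p →L[ℝ] IndepVar p => D (Pi.single i 1) :=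
    contDiff_id.clm_apply contDiff_const
  exact contDiff_pi.1 this (σ i)

/-- The derivative of the determinant at the identity is the trace, read off from the linear term of
`det (1 + t K)`. This is where `Div ξ` comes from. -/
theorem fderiv_det_id (K : IndepVar p →L[ℝ] IndepVar p) :
    fderiv ℝ (fun D : IndepVar p →L[ℝ] IndepVar p => D.det) (ContinuousLinearMap.id ℝ _) K =
      ∑ i, K (Pi.single i 1) i := by
  have h1 : HasDerivAt (fun t : ℝ => ContinuousLinearMap.id ℝ (IndepVar p) + t • K) K 0 := by
    simpa using ((hasDerivAt_id (0 : ℝ)).smul_const K).const_add (ContinuousLinearMap.id ℝ _)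
  have h2 : HasFDerivAt (fun D : IndepVar p →L[ℝ] IndepVar p => D.det)
      (fderiv ℝ (fun D : IndepVar p →L[ℝ] IndepVar p => D.det) (ContinuousLinearMap.id ℝ _))
      (ContinuousLinearMap.id ℝ (IndepVar p) + (0 : ℝ) • K) := by
    rw [zero_smul, add_zero]
    exact (contDiff_det.differentiable (by simp)).differentiableAt.hasFDerivAt
  have h3 := h2.comp_hasDerivAt (0 : ℝ) h1
  set M : Matrix (Fin p) (Fin p) ℝ := Matrix.of fun i j => K (Pi.single j 1) i with hM
  have h4 : ((fun D : IndepVar p →L[ℝ] IndepVar p => D.det) ∘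
      fun t : ℝ => ContinuousLinearMap.id ℝ (IndepVar p) + t • K) =
      fun t => Matrix.det (1 + t • M) := by
    funext t
    simp only [Function.comp_apply, det_eq_matrix_det]
    congr 1
    ext i j
    simp [hM, Matrix.one_apply, Pi.single_apply]
  rw [h4] at h3
  have h5 : HasDerivAt (fun t : ℝ => Matrix.det (1 + t • M)) M.trace 0 := by
    have : (fun t : ℝ => Matrix.det (1 + t • M)) = fun t => 1 + M.trace * t +
        (Matrix.det (1 + (Polynomial.X : Polynomial ℝ) • M.map Polynomial.C)).divX.divX.eval t
          * t ^ 2 := by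
      funext t
      exact Matrix.det_one_add_smul t M
    rw [this]
    set P := (Matrix.det (1 + (Polynomial.X : Polynomial ℝ) • M.map Polynomial.C)).divX.divX
    have := (((hasDerivAt_id (0 : ℝ)).const_mul M.trace).const_add 1).add
      ((P.hasDerivAt 0).mul (hasDerivAt_pow 2 (0 : ℝ)))
    convert! this using 1
    simp
  rw [h3.unique h5]
  rfl

end Det

variable {p q n : ℕ} {E : Type*} [NormedAddCommGroup E] [NormedSpace ℝ E]

/-! ### Smooth families of transformations -/

/-- Derivatives of a slice are derivatives of the joint function `F` in directions `(0, e_i)`; in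
that form their dependence on the parameter is visibly smooth. The slice is a translation followed
by a linear inclusion, on a neighbourhood where `F` is regular. -/
theorem partialDeriv_slice (l : List (Fin p)) {F : E × IndepVar p → DepVar q} {a : E}
    {y : IndepVar p} (hF : ContDiffAt ℝ l.length F (a, y)) :
    partialDeriv l (fun y => F (a, y)) y =
      iteratedFDeriv ℝ l.length F (a, y) fun k => (0, Pi.single (l.get k) 1) := by
  obtain ⟨u, hu, hFu⟩ := hF.contDiffOn le_rfl (by simp)
  obtain ⟨s, hsu, hso, hs⟩ := mem_nhds_iff.1 (by simpa using hu)
  have hcont : Continuous fun v : E × IndepVar p => (a, (0 : IndepVar p)) + v := by fun_prop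
  have hg : ContDiffOn ℝ l.length (fun v => F ((a, (0 : IndepVar p)) + v))
      ((fun v => (a, (0 : IndepVar p)) + v) ⁻¹' s) :=
    (hFu.mono hsu).comp (by fun_prop) fun v hv => hv
  have hso' := hso.preimage hcont
  have hso'' := hso'.preimage (ContinuousLinearMap.inr ℝ E (IndepVar p)).continuous
  have hy : ContinuousLinearMap.inr ℝ E (IndepVar p) y ∈
      (fun v => (a, (0 : IndepVar p)) + v) ⁻¹' s := by simpa using hs
  have key := (ContinuousLinearMap.inr ℝ E (IndepVar p)).iteratedFDerivWithin_comp_right hg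
    hso'.uniqueDiffOn hso''.uniqueDiffOn hy (i := l.length) le_rfl
  rw [iteratedFDerivWithin_of_isOpen _ hso'' hy, iteratedFDerivWithin_of_isOpen _ hso' hy,
    iteratedFDeriv_comp_add_left] at key
  have hcomp : (fun v => F ((a, (0 : IndepVar p)) + v)) ∘ ContinuousLinearMap.inr ℝ E (IndepVar p)
      = fun y => F (a, y) := by
    funext y
    simp
  rw [hcomp] at key
  rw [partialDeriv, key]
  simp

variable {B : E → TotalSpace p q → TotalSpace p q} {O : Set (E × TotalSpace p q)} {e₀ : E}

theorem contDiffAt_totalJacobian {m : TotalSpace p q}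
    (hB : ContDiffAt ℝ ∞ (fun y : E × TotalSpace p q => B y.1 y.2) (e₀, m))
    (u : IndepVar p →L[ℝ] DepVar q) :
    ContDiffAt ℝ ∞ (fun a => totalJacobian (B a) m u) e₀ := by
  have h1 : ContDiffAt ℝ ∞ (fun a => fderiv ℝ (fun m' => (B a m').1) m) e₀ :=
    ContDiffAt.fderiv (f := fun a m' => (B a m').1) (g := fun _ => m) hB.fst contDiffAt_const
      (by simp)
  exact h1.clm_comp contDiffAt_const

variable [FiniteDimensional ℝ E]

/-- Parameter and independent variables are inverted together: with `H (a, y) = (a, Ξ_a (y, f y))`,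
the function `F = Φ ∘ H⁻¹` is jointly smooth, and its slices `F (a, ·)` are the transforms of `f`.
-/
theorem contDiffAt_prolongMap (hn : 1 ≤ n) (hO : IsOpen O)
    (hB : ContDiffOn ℝ ∞ (fun y : E × TotalSpace p q => B y.1 y.2) O) {z : JetSpace p q n}
    (hz : (e₀, z.base) ∈ O)
    (hdet : (totalJacobian (B e₀) z.base (fderiv ℝ (taylorFun z) z.1)).det ≠ 0) :
    ContDiffAt ℝ ∞ (fun a => prolongMap n (B a) z) e₀ := by
  obtain ⟨x, u⟩ := z
  obtain ⟨f, hfs, hu, hbase, hd⟩ : ∃ f : IndepVar p → DepVar q, ContDiff ℝ ∞ f ∧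
      u = prolongFun n f x ∧ JetSpace.base ((x, u) : JetSpace p q n) = (x, f x) ∧
      fderiv ℝ (taylorFun ((x, u) : JetSpace p q n)) x = fderiv ℝ f x :=
    ⟨taylorFun ((x, u) : JetSpace p q n), contDiff_taylorFun _,
      (prolongFun_taylorFun ((x, u) : JetSpace p q n)).symm, base_eq _, rfl⟩
  simp only [hbase, hd] at hz hdet
  have hBe : ∀ {a m}, (a, m) ∈ O →
      ContDiffAt ℝ ∞ (fun y : E × TotalSpace p q => B y.1 y.2) (a, m) :=
    fun h => hB.contDiffAt (hO.mem_nhds h)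
  have hBa : ∀ {a m}, (a, m) ∈ O → ContDiffAt ℝ ∞ (B a) m := fun h =>
    ContDiffAt.comp (g := fun y : E × TotalSpace p q => B y.1 y.2) _ (hBe h)
      (contDiffAt_const.prodMk contDiffAt_id)
  let ι : E × IndepVar p → E × TotalSpace p q := fun y => (y.1, (y.2, f y.2))
  have hι : ContDiff ℝ ∞ ι := by fun_prop
  let O' : Set (E × IndepVar p) := ι ⁻¹' O
  have hO' : IsOpen O' := hO.preimage hι.continuous
  let H : E × IndepVar p → E × IndepVar p := fun y => (y.1, (B y.1 (y.2, f y.2)).1)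
  have hBι : ContDiffOn ℝ ∞ (fun y : E × IndepVar p => B y.1 (y.2, f y.2)) O' :=
    hB.comp hι.contDiffOn fun y hy => hy
  have hH : ContDiffOn ℝ ∞ H O' := contDiffOn_fst.prodMk hBι.fst
  -- The derivative of `H` is block triangular: a kernel vector has zero parameter part, and on the
  -- rest the total Jacobian acts.
  have hD : (fderiv ℝ H (e₀, x)).IsInvertible := by
    refine isInvertible_of_injective ((injective_iff_map_eq_zero _).2 fun v hv => ?_)
    have hHd : HasFDerivAt H (fderiv ℝ H (e₀, x)) (e₀, x) :=
      ((hH.contDiffAt (hO'.mem_nhds hz)).differentiableAt (by simp)).hasFDerivAt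
    have h1 : v.1 = 0 := by
      have : HasFDerivAt (fun y : E × IndepVar p => y.1)
        ((ContinuousLinearMap.fst ℝ E (IndepVar p)).comp (fderiv ℝ H (e₀, x))) (e₀, x) :=
          hHd.fst
      have h := this.unique hasFDerivAt_fst
      have := congrArg (fun D => D v) h
      simpa [hv] using this.symm
    obtain ⟨v₁, v₂⟩ := v
    simp only at h1
    subst h1
    have h2 : HasFDerivAt (fun y => (B e₀ (y, f y)).1)
        (((ContinuousLinearMap.snd ℝ E (IndepVar p)).comp (fderiv ℝ H (e₀, x))).comp
          (ContinuousLinearMap.inr ℝ E (IndepVar p))) x := by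
      have h3 : HasFDerivAt (fun y : IndepVar p => (e₀, y))
          (ContinuousLinearMap.inr ℝ E (IndepVar p)) x := hasFDerivAt_prodMk_right _ _
      exact HasFDerivAt.comp (g := fun y => (H y).2) x hHd.snd h3
    have h3 := h2.unique (hasFDerivAt_fst_graph ((hBa hz).differentiableAt (by simp))
      ((hfs.contDiffAt).differentiableAt (by simp)))
    obtain ⟨D, hD⟩ := isInvertible_of_det_ne_zero hdet
    have h4 : D v₂ = 0 := by
      have := congrArg (fun D => D v₂) (hD.trans h3.symm)
      simpa [hv] using this
    rw [D.map_eq_zero_iff] at h4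
    simp [h4]
  obtain ⟨e, hex, heO, heH, hesymm⟩ := exists_openPartialHomeomorph hO' hH hz hD
  let F : E × IndepVar p → DepVar q := fun y =>
    (B (e.symm y).1 ((e.symm y).2, f (e.symm y).2)).2
  have hF : ContDiffOn ℝ ∞ F e.target :=
    (hBι.comp hesymm fun y hy => heO (e.map_target hy)).snd
  have hFat : ∀ {y}, y ∈ e.target → ContDiffAt ℝ ∞ F y := fun hy =>
    hF.contDiffAt (e.open_target.mem_nhds hy)
  have hmem : ∀ {y}, y ∈ e.source → H y ∈ e.target := fun hy => heH ▸ e.map_source hy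
  have hFH : ∀ {y}, y ∈ e.source → F (H y) = (B y.1 (y.2, f y.2)).2 := fun {y} hy => by
    have : e.symm (H y) = y := heH ▸ e.left_inv hy
    simp only [F, this]
  have hcontx : ContinuousAt (fun a : E => (a, x)) e₀ := by fun_prop
  have hsrc : ∀ᶠ a in 𝓝 e₀, (a, x) ∈ e.source :=
    hcontx.eventually (e.open_source.mem_nhds hex)
  have hdet' : ∀ᶠ a in 𝓝 e₀, (totalJacobian (B a) (x, f x) (fderiv ℝ f x)).det ≠ 0 :=
    ((contDiff_det.continuous.continuousAt.comp
      (contDiffAt_totalJacobian (hBe hz) _).continuousAt).eventually_ne hdet)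
  have hgerm : ∀ {a}, (a, x) ∈ e.source → IsGermTransform (B a) f x fun y => F (a, y) := by
    intro a ha
    refine ⟨ContDiffAt.comp (g := F) _ (hFat (hmem ha)) (contDiffAt_const.prodMk contDiffAt_id), ?_⟩
    have hc : ContinuousAt (fun y : IndepVar p => (a, y)) x := by fun_prop
    filter_upwards [hc.eventually (e.open_source.mem_nhds ha)] with y hy
    exact hFH hy
  have hev : (fun a => prolongMap n (B a) ((x, u) : JetSpace p q n)) =ᶠ[𝓝 e₀] fun a =>
      ((B a (x, f x)).1, fun J => iteratedFDeriv ℝ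
        ((J.2 : Multiset (Fin p)).sort (· ≤ ·)).length F (a, (B a (x, f x)).1)
        fun k => (0, Pi.single (((J.2 : Multiset (Fin p)).sort (· ≤ ·)).get k) 1)) := by
    filter_upwards [hsrc, hdet'] with a ha hda
    rw [hu, prolongMap_eq hn (hgerm ha) (hBa (heO ha)) hfs.contDiffAt hda]
    congr 1
    funext J
    exact partialDeriv_slice _ ((hFat (hmem ha)).of_le (by exact_mod_cast le_top))
  refine ContDiffAt.congr_of_eventuallyEq ?_ hev
  have hΞ : ContDiffAt ℝ ∞ (fun a => (B a (x, f x)).1) e₀ :=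
    (ContDiffAt.comp (g := fun y : E × TotalSpace p q => B y.1 y.2) e₀ (hBe hz)
      (contDiffAt_id.prodMk contDiffAt_const)).fst
  refine hΞ.prodMk (contDiffAt_pi.2 fun J => ?_)
  refine (ContinuousMultilinearMap.apply ℝ (fun _ => E × IndepVar p) (DepVar q)
    _).contDiff.comp_contDiffAt e₀ (f := fun a => iteratedFDeriv ℝ
        ((J.2 : Multiset (Fin p)).sort (· ≤ ·)).length F (a, (B a (x, f x)).1)) ?_
  exact ContDiffAt.comp e₀ ((hFat (hmem hex)).iteratedFDeriv_right (m := ∞)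
    (by exact_mod_cast le_top)) (contDiffAt_id.prodMk hΞ)

end VarSym

namespace VarSym

namespace LocalTransformationGroup

variable {p q n d : ℕ} {G : Type*} [TopologicalSpace G] [ChartedSpace (EuclideanSpace ℝ (Fin d)) G]
  [Group G] [LieGroup (𝓡 d) ∞ G] {M : Set (TotalSpace p q)}

/-! ### Coordinates on the group near the identity -/

variable (d G) in
/-- The coordinates of the identity. -/
def coordOne : EuclideanSpace ℝ (Fin d) := extChartAt (𝓡 d) (1 : G) 1

variable (d G) in
/-- The group element with given coordinates near the identity. -/
def ofCoord (a : EuclideanSpace ℝ (Fin d)) : G := (extChartAt (𝓡 d) (1 : G)).symm a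

variable (d G) in
/-- The group multiplication in coordinates near the identity. -/
def coordMul (y : EuclideanSpace ℝ (Fin d) × EuclideanSpace ℝ (Fin d)) :
    EuclideanSpace ℝ (Fin d) :=
  extChartAt (𝓡 d) (1 : G) (ofCoord d G y.1 * ofCoord d G y.2)

@[simp] theorem ofCoord_coordOne : ofCoord d G (coordOne d G) = 1 :=
  extChartAt_to_inv (I := 𝓡 d) (1 : G)

theorem continuousAt_ofCoord {a : EuclideanSpace ℝ (Fin d)}
    (ha : a ∈ (extChartAt (𝓡 d) (1 : G)).target) : ContinuousAt (ofCoord d G) a :=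
  (continuousOn_extChartAt_symm (I := 𝓡 d) (1 : G)).continuousAt
    ((isOpen_extChartAt_target (I := 𝓡 d) (1 : G)).mem_nhds ha)

theorem coordOne_mem : coordOne d G ∈ (extChartAt (𝓡 d) (1 : G)).target :=
  mem_extChartAt_target (I := 𝓡 d) (1 : G)

theorem target_mem_nhds : (extChartAt (𝓡 d) (1 : G)).target ∈ 𝓝 (coordOne d G) :=
  (isOpen_extChartAt_target (I := 𝓡 d) (1 : G)).mem_nhds coordOne_mem

theorem tendsto_ofCoord : Filter.Tendsto (ofCoord d G) (𝓝 (coordOne d G)) (𝓝 1) := by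
  have := continuousAt_ofCoord (G := G) (coordOne_mem (d := d) (G := G))
  rwa [ContinuousAt, ofCoord_coordOne] at this

/-- Properties that hold near the identity can be checked in coordinates. -/
theorem eventually_nhds_one_iff {P : G → Prop} :
    (∀ᶠ g in 𝓝 1, P g) ↔ ∀ᶠ a in 𝓝 (coordOne d G), P (ofCoord d G a) := by
  refine ⟨fun h => tendsto_ofCoord.eventually h, fun h => ?_⟩
  have hc : ContinuousAt (extChartAt (𝓡 d) (1 : G)) 1 := continuousAt_extChartAt (1 : G)
  filter_upwards [hc.eventually h, extChartAt_source_mem_nhds (I := 𝓡 d) (1 : G)] with g hg hg'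
  have : ofCoord d G (extChartAt (𝓡 d) (1 : G) g) = g := (extChartAt (𝓡 d) (1 : G)).left_inv hg'
  rwa [this] at hg

theorem coordMul_coordOne_right {a : EuclideanSpace ℝ (Fin d)}
    (ha : a ∈ (extChartAt (𝓡 d) (1 : G)).target) : coordMul d G (a, coordOne d G) = a := by
  simp only [coordMul, ofCoord_coordOne, mul_one]
  exact (extChartAt (𝓡 d) (1 : G)).right_inv ha

theorem coordMul_coordOne_left {a : EuclideanSpace ℝ (Fin d)}
    (ha : a ∈ (extChartAt (𝓡 d) (1 : G)).target) : coordMul d G (coordOne d G, a) = a := by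
  simp only [coordMul, ofCoord_coordOne, one_mul]
  exact (extChartAt (𝓡 d) (1 : G)).right_inv ha

theorem contMDiffOn_ofCoord : ContMDiffOn 𝓘(ℝ, EuclideanSpace ℝ (Fin d)) (𝓡 d) ∞
    (ofCoord d G) (extChartAt (𝓡 d) (1 : G)).target := by
  exact contMDiffOn_extChartAt_symm (1 : G)

/-- Only for factors near the identity is the product sure to stay in the chart. -/
theorem eventually_ofCoord_coordMul :
    ∀ᶠ y in 𝓝 (coordOne d G, coordOne d G),
      ofCoord d G (coordMul d G y) = ofCoord d G y.1 * ofCoord d G y.2 := by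
  have : IsTopologicalGroup G := topologicalGroup_of_lieGroup (𝓡 d) ∞
  have hc : Filter.Tendsto (fun y : EuclideanSpace ℝ (Fin d) × EuclideanSpace ℝ (Fin d) =>
      ofCoord d G y.1 * ofCoord d G y.2) (𝓝 (coordOne d G, coordOne d G)) (𝓝 1) := by
    rw [nhds_prod_eq, ← one_mul (1 : G)]
    exact (tendsto_ofCoord.comp Filter.tendsto_fst).mul (tendsto_ofCoord.comp Filter.tendsto_snd)
  filter_upwards [hc.eventually (extChartAt_source_mem_nhds (I := 𝓡 d) (1 : G))] with y hy
  exact (extChartAt (𝓡 d) (1 : G)).left_inv hy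

theorem contDiffAt_coordMul : ContDiffAt ℝ ∞ (coordMul d G) (coordOne d G, coordOne d G) := by
  rw [← contMDiffAt_iff_contDiffAt]
  have h1 : ContMDiffAt 𝓘(ℝ, EuclideanSpace ℝ (Fin d)) (𝓡 d) ∞ (ofCoord d G) (coordOne d G) :=
    contMDiffOn_ofCoord.contMDiffAt target_mem_nhds
  have h2 : ContMDiffAt 𝓘(ℝ, EuclideanSpace ℝ (Fin d) × EuclideanSpace ℝ (Fin d)) (𝓡 d) ∞
      (fun y : EuclideanSpace ℝ (Fin d) × EuclideanSpace ℝ (Fin d) =>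
        ofCoord d G y.1 * ofCoord d G y.2) (coordOne d G, coordOne d G) := by
    refine ContMDiffAt.mul ?_ ?_
    · exact ContMDiffAt.comp _ h1 contDiffAt_fst.contMDiffAt
    · exact ContMDiffAt.comp _ h1 contDiffAt_snd.contMDiffAt
  have h3 : ContMDiffAt (𝓡 d) 𝓘(ℝ, EuclideanSpace ℝ (Fin d)) ∞ (extChartAt (𝓡 d) (1 : G))
      (ofCoord d G (coordOne d G) * ofCoord d G (coordOne d G)) := by
    rw [ofCoord_coordOne, mul_one]
    exact contMDiffAt_extChartAt
  exact ContMDiffAt.comp _ h3 h2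

variable (A : LocalTransformationGroup d G M)

/-- The action in coordinates near the identity. -/
def coordAct (a : EuclideanSpace ℝ (Fin d)) (m : TotalSpace p q) : TotalSpace p q :=
  A.act (ofCoord d G a) m

/-- The domain of the action in coordinates near the identity. -/
def coordDomain : Set (EuclideanSpace ℝ (Fin d) × TotalSpace p q) :=
  {y | y.1 ∈ (extChartAt (𝓡 d) (1 : G)).target ∧ (ofCoord d G y.1, y.2) ∈ A.domain}

theorem isOpen_coordDomain : IsOpen A.coordDomain := by
  have h : ContinuousOn (fun y : EuclideanSpace ℝ (Fin d) × TotalSpace p q =>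
      (ofCoord d G y.1, y.2)) (Prod.fst ⁻¹' (extChartAt (𝓡 d) (1 : G)).target) :=
    ((continuousOn_extChartAt_symm (I := 𝓡 d) (1 : G)).comp continuousOn_fst
      fun y hy => hy).prodMk continuousOn_snd
  exact h.isOpen_inter_preimage
    ((isOpen_extChartAt_target (I := 𝓡 d) (1 : G)).preimage continuous_fst) A.isOpen_domain

theorem coordOne_mem_coordDomain {m : TotalSpace p q} (hm : m ∈ M) :
    (coordOne d G, m) ∈ A.coordDomain :=
  ⟨coordOne_mem, by simpa using A.one_mem m hm⟩

theorem contDiffOn_coordAct : ContDiffOn ℝ ∞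
    (fun y : EuclideanSpace ℝ (Fin d) × TotalSpace p q => A.coordAct y.1 y.2) A.coordDomain := by
  rw [← contMDiffOn_iff_contDiffOn]
  have h1 : ContMDiffOn 𝓘(ℝ, EuclideanSpace ℝ (Fin d) × TotalSpace p q) (𝓡 d) ∞
      (fun y : EuclideanSpace ℝ (Fin d) × TotalSpace p q => ofCoord d G y.1) A.coordDomain :=
    contMDiffOn_ofCoord.comp contDiffOn_fst.contMDiffOn fun y hy => hy.1
  have h2 : ContMDiffOn 𝓘(ℝ, EuclideanSpace ℝ (Fin d) × TotalSpace p q) 𝓘(ℝ, TotalSpace p q) ∞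
      (fun y : EuclideanSpace ℝ (Fin d) × TotalSpace p q => y.2) A.coordDomain :=
    contDiffOn_snd.contMDiffOn
  exact A.smooth_act.comp (h1.prodMk h2) fun y hy => hy.2

theorem contDiffAt_coordAct {a : EuclideanSpace ℝ (Fin d)} {m : TotalSpace p q}
    (h : (a, m) ∈ A.coordDomain) : ContDiffAt ℝ ∞
    (fun y : EuclideanSpace ℝ (Fin d) × TotalSpace p q => A.coordAct y.1 y.2) (a, m) :=
  A.contDiffOn_coordAct.contDiffAt (A.isOpen_coordDomain.mem_nhds h)

theorem coordAct_coordOne_eq : A.coordAct (coordOne d G) = A.act 1 := by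
  funext m
  simp [coordAct]

theorem coordAct_coordOne {m : TotalSpace p q} (hm : m ∈ M) :
    A.coordAct (coordOne d G) m = m := by
  simp [coordAct, A.one_act m hm]

/-- Each group element acts smoothly. -/
theorem contDiffAt_act {g : G} {m : TotalSpace p q} (h : (g, m) ∈ A.domain) :
    ContDiffAt ℝ ∞ (A.act g) m := by
  rw [← contMDiffAt_iff_contDiffAt]
  have h1 : ContMDiffAt 𝓘(ℝ, TotalSpace p q) ((𝓡 d).prod 𝓘(ℝ, TotalSpace p q)) ∞
      (fun m : TotalSpace p q => (g, m)) m := contMDiffAt_const.prodMk contMDiffAt_id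
  exact ContMDiffAt.comp (g := fun y : G × TotalSpace p q => A.act y.1 y.2) m
    (A.smooth_act.contMDiffAt (A.isOpen_domain.mem_nhds h)) h1

/-- The manifold derivative at the identity is by definition taken in the chart whose inverse is
`ofCoord`. -/
theorem generator_eq (w : GroupLieAlgebra (𝓡 d) G) {m : TotalSpace p q} (hm : m ∈ M) :
    A.generator w m = fderiv ℝ (fun a => A.coordAct a m) (coordOne d G) w := by
  have h : MDifferentiableAt (𝓡 d) 𝓘(ℝ, TotalSpace p q) (fun g : G => A.act g m) 1 := by
    have h1 : ContMDiffAt (𝓡 d) ((𝓡 d).prod 𝓘(ℝ, TotalSpace p q)) ∞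
        (fun g : G => (g, m)) 1 := contMDiffAt_id.prodMk contMDiffAt_const
    exact (ContMDiffAt.comp (g := fun y : G × TotalSpace p q => A.act y.1 y.2) 1
      (A.smooth_act.contMDiffAt (A.isOpen_domain.mem_nhds (A.one_mem m hm))) h1).mdifferentiableAt
        (by simp)
  have h' : fderivWithin ℝ (writtenInExtChartAt (𝓡 d) 𝓘(ℝ, TotalSpace p q) (1 : G)
      fun g : G => A.act g m) (range (𝓡 d)) (extChartAt (𝓡 d) (1 : G) 1) =
      fderiv ℝ (fun a => A.coordAct a m) (coordOne d G) := by
    rw [ModelWithCorners.range_eq_univ, fderivWithin_univ]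
    rfl
  rw [← h']
  exact congrArg (fun D => D w) h.mfderiv

end LocalTransformationGroup

end VarSym

/-! ### The pulled back Lagrangian and its cocycle identity -/

namespace VarSym

variable {p q n d : ℕ}

/-- The total Jacobian of `ψ` at a jet. -/
def jetJacobian (ψ : TotalSpace p q → TotalSpace p q) (z : JetSpace p q n) :
    IndepVar p →L[ℝ] IndepVar p :=
  totalJacobian ψ z.base (fderiv ℝ (taylorFun z) z.1)

/-- The Lagrangian `L (pr^(n) ψ · z) det J_ψ (z)` pulled back by `ψ`. -/
def pullbackLagrangian (L : JetSpace p q n → ℝ) (ψ : TotalSpace p q → TotalSpace p q)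
    (z : JetSpace p q n) : ℝ :=
  L (prolongMap n ψ z) * (jetJacobian ψ z).det

theorem jetJacobian_prolongFun (hn : 1 ≤ n) (ψ : TotalSpace p q → TotalSpace p q)
    {f : IndepVar p → DepVar q} {x : IndepVar p} (hf : ContDiffAt ℝ ∞ f x) :
    jetJacobian ψ ((x, prolongFun n f x) : JetSpace p q n) =
      totalJacobian ψ (x, f x) (fderiv ℝ f x) := by
  rw [jetJacobian, base_prolongFun, (sameJet_taylorFun (n := n) hf).fderiv_eq hn]

theorem eq_prolongFun (z : JetSpace p q n) :
    z = (z.1, prolongFun n (taylorFun z) z.1) := by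
  rw [prolongFun_taylorFun]

theorem totalJacobian_of_eventuallyEq_id {ψ : TotalSpace p q → TotalSpace p q}
    {m : TotalSpace p q} (h : ψ =ᶠ[𝓝 m] id) (a : IndepVar p →L[ℝ] DepVar q) :
    totalJacobian ψ m a = ContinuousLinearMap.id ℝ _ := by
  have : (fun m' => (ψ m').1) =ᶠ[𝓝 m] fun m' => m'.1 := h.mono fun m' hm' =>
    congrArg Prod.fst hm'
  rw [totalJacobian, this.fderiv_eq, fderiv_fst]
  rfl

namespace LocalTransformationGroup

variable {G : Type*} [TopologicalSpace G] [ChartedSpace (EuclideanSpace ℝ (Fin d)) G]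
  [Group G] [LieGroup (𝓡 d) ∞ G] {M : Set (TotalSpace p q)}
  (A : LocalTransformationGroup d G M)

/-! ### The prolonged action -/

theorem act_one_eventuallyEq (hM : IsOpen M) {m : TotalSpace p q} (hm : m ∈ M) :
    A.act 1 =ᶠ[𝓝 m] id := by
  filter_upwards [hM.mem_nhds hm] with m' hm'
  exact A.one_act m' hm'

/-- The determinant is continuous in `k` and equals `1` at the identity. Positivity, rather than
nonvanishing, later removes the absolute value in the change of variables. -/
theorem eventually_det_pos (hM : IsOpen M) {m : TotalSpace p q} (hm : m ∈ M)
    (a : IndepVar p →L[ℝ] DepVar q) :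
    ∀ᶠ k in 𝓝 (1 : G), 0 < (totalJacobian (A.act k) m a).det := by
  rw [eventually_nhds_one_iff (d := d)]
  have h : ContinuousAt (fun b => (totalJacobian (A.coordAct b) m a).det) (coordOne d G) :=
    contDiff_det.continuous.continuousAt.comp (contDiffAt_totalJacobian
      (A.contDiffAt_coordAct (A.coordOne_mem_coordDomain hm)) a).continuousAt
  refine h.eventually (lt_mem_nhds ?_)
  simp only [coordAct_coordOne_eq]
  rw [totalJacobian_of_eventuallyEq_id (A.act_one_eventuallyEq hM hm)]
  simp [ContinuousLinearMap.det]

/-- The three membership conditions of `act_act` are open in `(k, m')` and hold at `(1, m)`. The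
identity is needed as one of germs in `m'`, since prolongation differentiates it. -/
theorem eventually_act_mul {h : G} {m : TotalSpace p q} (hm : (h, m) ∈ A.domain) :
    ∀ᶠ k in 𝓝 (1 : G), (k, A.act h m) ∈ A.domain ∧ (k * h, m) ∈ A.domain ∧
      ∀ᶠ m' in 𝓝 m, A.act (k * h) m' = A.act k (A.act h m') := by
  have : IsTopologicalGroup G := topologicalGroup_of_lieGroup (𝓡 d) ∞
  have hM : A.act h m ∈ M := A.act_mem h m hm
  have h1 : ∀ᶠ y in 𝓝 ((1 : G), m), (h, y.2) ∈ A.domain := by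
    have hc : ContinuousAt (fun y : G × TotalSpace p q => (h, y.2)) (1, m) := by fun_prop
    exact hc.eventually (A.isOpen_domain.mem_nhds hm)
  have h2 : ∀ᶠ y in 𝓝 ((1 : G), m), (y.1, A.act h y.2) ∈ A.domain := by
    have hc : ContinuousAt (fun y : G × TotalSpace p q => (y.1, A.act h y.2)) (1, m) :=
      continuousAt_fst.prodMk (ContinuousAt.comp (g := A.act h)
        (A.contDiffAt_act hm).continuousAt continuousAt_snd)
    exact hc.eventually (A.isOpen_domain.mem_nhds (A.one_mem _ hM))
  have h3 : ∀ᶠ y in 𝓝 ((1 : G), m), (y.1 * h, y.2) ∈ A.domain := by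
    have hc : ContinuousAt (fun y : G × TotalSpace p q => (y.1 * h, y.2)) (1, m) := by fun_prop
    exact hc.eventually (A.isOpen_domain.mem_nhds (by simpa using hm))
  have h4 := h1.and (h2.and h3)
  rw [nhds_prod_eq] at h4
  filter_upwards [h4.curry] with k hk
  refine ⟨hk.self_of_nhds.2.1, hk.self_of_nhds.2.2, hk.mono fun m' hm' => ?_⟩
  exact (A.act_act k h m' hm'.1 hm'.2.1 hm'.2.2).symm

theorem exists_isGermTransform_act {h : G} {z : JetSpace p q n}
    (hm : (h, z.base) ∈ A.domain) (hdet : (jetJacobian (A.act h) z).det ≠ 0) :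
    ∃ f', IsGermTransform (A.act h) (taylorFun z) z.1 f' := by
  rw [base_eq] at hm
  rw [jetJacobian, base_eq] at hdet
  exact exists_isGermTransform (A.contDiffAt_act hm) (contDiff_taylorFun z).contDiffAt hdet

theorem prolongMap_eq_of_germ (hn : 1 ≤ n) {h : G} {z : JetSpace p q n}
    (hm : (h, z.base) ∈ A.domain) (hdet : (jetJacobian (A.act h) z).det ≠ 0)
    {f' : IndepVar p → DepVar q} (hf' : IsGermTransform (A.act h) (taylorFun z) z.1 f') :
    prolongMap n (A.act h) z =
      ((A.act h z.base).1, prolongFun n f' (A.act h z.base).1) := by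
  rw [base_eq] at hm
  rw [jetJacobian, base_eq] at hdet
  have := prolongMap_eq hn hf' (A.contDiffAt_act hm) (contDiff_taylorFun z).contDiffAt hdet
  rwa [← eq_prolongFun, ← base_eq] at this

theorem base_prolongMap (hn : 1 ≤ n) {h : G} {z : JetSpace p q n}
    (hm : (h, z.base) ∈ A.domain) (hdet : (jetJacobian (A.act h) z).det ≠ 0) :
    (prolongMap n (A.act h) z).base = A.act h z.base := by
  obtain ⟨f', hf'⟩ := A.exists_isGermTransform_act hm hdet
  rw [A.prolongMap_eq_of_germ hn hm hdet hf', base_prolongFun]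
  have := hf'.2.self_of_nhds
  rw [← base_eq] at this
  rw [this]

theorem prolongMap_mem_jetSet (hn : 1 ≤ n) {h : G} {z : JetSpace p q n}
    (hm : (h, z.base) ∈ A.domain) (hdet : (jetJacobian (A.act h) z).det ≠ 0) :
    prolongMap n (A.act h) z ∈ jetSet n M := by
  rw [jetSet, mem_ofPred_eq, A.base_prolongMap hn hm hdet]
  exact A.act_mem _ _ hm

/-- The prolonged action and its Jacobian are compatible with the group multiplication. -/
theorem eventually_prolongMap_mul (hn : 1 ≤ n) (hM : IsOpen M) {h : G} {z : JetSpace p q n}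
    (hm : (h, z.base) ∈ A.domain) (hdet : (jetJacobian (A.act h) z).det ≠ 0) :
    ∀ᶠ k in 𝓝 (1 : G),
      prolongMap n (A.act (k * h)) z = prolongMap n (A.act k) (prolongMap n (A.act h) z) ∧
      jetJacobian (A.act (k * h)) z =
        (jetJacobian (A.act k) (prolongMap n (A.act h) z)).comp (jetJacobian (A.act h) z) := by
  obtain ⟨f', hf'⟩ := A.exists_isGermTransform_act hm hdet
  rw [A.prolongMap_eq_of_germ hn hm hdet hf']
  have hdet₀ := hdet
  rw [jetJacobian] at hdet
  -- The Taylor polynomial becomes an opaque `f`, so that rewriting `z` does not act inside it.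
  obtain ⟨f, hf, hz, hb, hfd, hfe⟩ : ∃ f : IndepVar p → DepVar q, ContDiff ℝ ∞ f ∧
      z = (z.1, prolongFun n f z.1) ∧ z.base = (z.1, f z.1) ∧
      fderiv ℝ (taylorFun z) z.1 = fderiv ℝ f z.1 ∧ taylorFun z = f :=
    ⟨taylorFun z, contDiff_taylorFun z, eq_prolongFun z, base_eq z, rfl, rfl⟩
  rw [hfd] at hdet
  rw [hfe] at hf'
  obtain ⟨x, u⟩ := z
  simp only at hz hb hf' hdet
  rw [hb] at hm hdet ⊢
  rw [hz]
  have hψ := A.contDiffAt_act hm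
  have hx' : f' (A.act h (x, f x)).1 = (A.act h (x, f x)).2 := hf'.2.self_of_nhds
  have hpt : ((A.act h (x, f x)).1, f' (A.act h (x, f x)).1) = A.act h (x, f x) := by rw [hx']
  have hev := A.eventually_det_pos hM (A.act_mem _ _ hm) (fderiv ℝ f' (A.act h (x, f x)).1)
  filter_upwards [hev, A.eventually_act_mul hm] with k hk1 hk2
  obtain ⟨hk2, hk3, hk4⟩ := hk2
  have hψk := A.contDiffAt_act hk2
  rw [← hpt] at hψk hk1
  obtain ⟨f'', hf''⟩ := exists_isGermTransform hψk hf'.1 hk1.ne'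
  have hcont : ContinuousAt (fun y => (A.act h (y, f y)).1) x :=
    (contDiffAt_graph hψ hf.contDiffAt).fst.continuousAt
  have hgraph : ContinuousAt (fun y => (y, f y)) x := by
    have := hf.continuous
    fun_prop
  have hact : ∀ᶠ y in 𝓝 x, A.act (k * h) (y, f y) =
      A.act k ((A.act h (y, f y)).1, f' (A.act h (y, f y)).1) := by
    filter_upwards [hgraph.eventually hk4, hf'.2] with y hy hy'
    rw [hy, hy']
  have hf''x := hact.self_of_nhds
  -- The function `f'' = k · f' = k · (h · f)` also represents `(k h) · f`.
  have hgerm : IsGermTransform (A.act (k * h)) f x f'' := by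
    refine ⟨?_, ?_⟩
    · rw [hf''x]
      exact hf''.1
    · filter_upwards [hact, hcont.eventually hf''.2] with y hy hy'
      rw [hy]
      exact hy'
  have hψkh := A.contDiffAt_act hk3
  have hjac : totalJacobian (A.act (k * h)) (x, f x) (fderiv ℝ f x) =
      (totalJacobian (A.act k) ((A.act h (x, f x)).1, f' (A.act h (x, f x)).1)
        (fderiv ℝ f' (A.act h (x, f x)).1)).comp
        (totalJacobian (A.act h) (x, f x) (fderiv ℝ f x)) := by
    have d1 := hasFDerivAt_fst_graph (hψkh.differentiableAt (by simp))
      (hf.contDiffAt.differentiableAt (by simp))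
    have d2 := hasFDerivAt_fst_graph (hψ.differentiableAt (by simp))
      (hf.contDiffAt.differentiableAt (by simp))
    have d3 := hasFDerivAt_fst_graph (hψk.differentiableAt (by simp))
      (hf'.1.differentiableAt (by simp))
    have d4 := HasFDerivAt.comp (g := fun y => (A.act k (y, f' y)).1)
      (f := fun y => (A.act h (y, f y)).1) x d3 d2
    exact d1.unique (d4.congr_of_eventuallyEq (hact.mono fun y hy => by
      simp only [hy, Function.comp_apply]))
  have hdetkh : (totalJacobian (A.act (k * h)) (x, f x) (fderiv ℝ f x)).det ≠ 0 := by
    rw [hjac, ContinuousLinearMap.det, ContinuousLinearMap.toLinearMap_comp, LinearMap.det_comp]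
    exact mul_ne_zero hk1.ne' hdet
  refine ⟨?_, ?_⟩
  · rw [prolongMap_eq hn hgerm hψkh hf.contDiffAt hdetkh,
      prolongMap_eq hn hf'' hψk hf'.1 hk1.ne', ← hf''x]
  · rw [jetJacobian_prolongFun hn _ hf.contDiffAt, jetJacobian_prolongFun hn _ hf'.1,
      jetJacobian_prolongFun hn _ hf.contDiffAt, hjac]

/-- The cocycle identity for `L dx`: it carries information at the identity, known at every jet, to
the group element `h`. -/
theorem eventually_pullbackLagrangian_mul (hn : 1 ≤ n) (hM : IsOpen M) (L : JetSpace p q n → ℝ)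
    {h : G} {z : JetSpace p q n} (hm : (h, z.base) ∈ A.domain)
    (hdet : (jetJacobian (A.act h) z).det ≠ 0) :
    ∀ᶠ k in 𝓝 (1 : G), pullbackLagrangian L (A.act (k * h)) z =
      pullbackLagrangian L (A.act k) (prolongMap n (A.act h) z) *
        (jetJacobian (A.act h) z).det := by
  filter_upwards [A.eventually_prolongMap_mul hn hM hm hdet] with k hk
  rw [pullbackLagrangian, pullbackLagrangian, hk.1, hk.2, ContinuousLinearMap.det,
    ContinuousLinearMap.toLinearMap_comp, LinearMap.det_comp]
  simp only [ContinuousLinearMap.det]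
  ring

/-! ### Local invariance of the Lagrangian -/

/-- Group elements near the identity preserve `L dx`. -/
def LocallyInvariant (L : JetSpace p q n → ℝ) : Prop :=
  ∀ z ∈ jetSet n M, ∀ᶠ g in 𝓝 (1 : G), pullbackLagrangian L (A.act g) z = L z

/-- By the cocycle identity, the pulled back Lagrangian and the sign of the determinant are locally
constant in the group element, hence constant on the connected prolonged domain. -/
theorem LocallyInvariant.pullbackLagrangian_eq {L : JetSpace p q n → ℝ}
    {A : LocalTransformationGroup d G M} (hA : A.LocallyInvariant L) (hn : 1 ≤ n) (hM : IsOpen M)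
    {z : JetSpace p q n} (hz : z ∈ jetSet n M) {g : G}
    (hg : g ∈ A.prolongedDomain z.base (fderiv ℝ (taylorFun z) z.1)) :
    pullbackLagrangian L (A.act g) z = L z ∧ 0 < (jetJacobian (A.act g) z).det := by
  have : IsTopologicalGroup G := topologicalGroup_of_lieGroup (𝓡 d) ∞
  have h1 : (1 : G) ∈ {g : G | (g, z.base) ∈ A.domain ∧
      (totalJacobian (A.act g) z.base (fderiv ℝ (taylorFun z) z.1)).det ≠ 0} :=
    ⟨A.one_mem _ hz, (A.eventually_det_pos hM hz _).self_of_nhds.ne'⟩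
  have hP : (pullbackLagrangian L (A.act g) z = pullbackLagrangian L (A.act 1) z ∧
      (0 < (jetJacobian (A.act g) z).det ↔ 0 < (jetJacobian (A.act 1) z).det)) := by
    refine IsPreconnected.induction₂' (s := A.prolongedDomain z.base (fderiv ℝ (taylorFun z) z.1))
      isPreconnected_connectedComponentIn
      (fun g h => pullbackLagrangian L (A.act g) z = pullbackLagrangian L (A.act h) z ∧
        (0 < (jetJacobian (A.act g) z).det ↔ 0 < (jetJacobian (A.act h) z).det)) ?_ ?_ hg
      (mem_connectedComponentIn h1)
    · intro h hh
      obtain ⟨hm, hdet⟩ := connectedComponentIn_subset _ _ hh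
      have hdet : (jetJacobian (A.act h) z).det ≠ 0 := hdet
      have hz' := A.prolongMap_mem_jetSet hn hm hdet
      have key : ∀ᶠ k in 𝓝 (1 : G),
          pullbackLagrangian L (A.act (k * h)) z = pullbackLagrangian L (A.act h) z ∧
          (0 < (jetJacobian (A.act (k * h)) z).det ↔ 0 < (jetJacobian (A.act h) z).det) := by
        filter_upwards [A.eventually_pullbackLagrangian_mul hn hM L hm hdet,
          A.eventually_prolongMap_mul hn hM hm hdet, hA _ hz',
          A.eventually_det_pos hM hz' (fderiv ℝ (taylorFun (prolongMap n (A.act h) z))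
            (prolongMap n (A.act h) z).1)] with k hk1 hk2 hk3 hk4
        refine ⟨by rw [hk1, hk3]; rfl, ?_⟩
        rw [hk2.2, ContinuousLinearMap.det, ContinuousLinearMap.toLinearMap_comp,
          LinearMap.det_comp]
        exact mul_pos_iff_of_pos_left hk4
      have key' : ∀ᶠ k in 𝓝 h,
          pullbackLagrangian L (A.act k) z = pullbackLagrangian L (A.act h) z ∧
          (0 < (jetJacobian (A.act k) z).det ↔ 0 < (jetJacobian (A.act h) z).det) := by
        -- Right translation by `h` turns neighbourhoods of the identity into neighbourhoods of `h`.
        rw [← map_mul_right_nhds_one h]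
        exact key
      refine (key'.filter_mono nhdsWithin_le_nhds).mono fun k hk => ?_
      exact ⟨⟨hk.1.symm, hk.2.symm⟩, hk⟩
    · rintro a b c - - - ⟨h1, h2⟩ ⟨h3, h4⟩
      exact ⟨h1.trans h3, h2.trans h4⟩
  refine ⟨hP.1.trans (hA z hz).self_of_nhds, hP.2.2 (A.eventually_det_pos hM hz _).self_of_nhds⟩

/-! ### From local invariance to invariance of the integral -/

/-- The change of variables defined by a transformation of functions. -/
theorem IsTransform.changeOfVariables {A : LocalTransformationGroup d G M} {g : G}
    {Ω Ω' : Set (IndepVar p)} {f f' : IndepVar p → DepVar q} (h : A.IsTransform g Ω f Ω' f')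
    (hΩ : IsOpen Ω) (hf : ContDiffOn ℝ ∞ f Ω) :
    (fun x => (A.act g (x, f x)).1) '' Ω = Ω' ∧ InjOn (fun x => (A.act g (x, f x)).1) Ω ∧
      (∀ x ∈ Ω, HasFDerivWithinAt (fun x => (A.act g (x, f x)).1)
        (totalJacobian (A.act g) (x, f x) (fderiv ℝ f x)) Ω x) ∧
      ∀ x ∈ Ω, IsGermTransform (A.act g) f x f' := by
  obtain ⟨hdom, hΩ', hf', himg⟩ := h
  have hd : ∀ x ∈ Ω, (g, (x, f x)) ∈ A.domain := fun x hx =>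
    (connectedComponentIn_subset _ _ (hdom x hx)).1
  have hfx : ∀ x ∈ Ω, ContDiffAt ℝ ∞ f x := fun x hx => hf.contDiffAt (hΩ.mem_nhds hx)
  have hmem : ∀ x ∈ Ω, (A.act g (x, f x)).1 ∈ Ω' ∧
      f' (A.act g (x, f x)).1 = (A.act g (x, f x)).2 := fun x hx => by
    have : A.act g (x, f x) ∈ Ω'.graphOn f' := himg ▸ mem_image_of_mem _ (mem_image_of_mem _ hx)
    obtain ⟨y, hy, hyx⟩ := this
    rw [← hyx]
    exact ⟨hy, rfl⟩
  refine ⟨?_, ?_, ?_, ?_⟩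
  · ext y
    constructor
    · rintro ⟨x, hx, rfl⟩
      exact (hmem x hx).1
    · intro hy
      have : (y, f' y) ∈ A.act g '' Ω.graphOn f := himg ▸ mem_image_of_mem _ hy
      obtain ⟨_, ⟨x, hx, rfl⟩, hxy⟩ := this
      exact ⟨x, hx, by simp only [hxy]⟩
  -- A point of the graph of `f'` is determined by its first component, so the two images coincide,
  -- and acting by `g⁻¹` recovers the original points.
  · intro x hx y hy hxy
    have hact : A.act g (x, f x) = A.act g (y, f y) := by
      refine Prod.ext hxy ?_
      rw [← (hmem x hx).2, ← (hmem y hy).2]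
      exact congrArg f' hxy
    have hinv : ∀ x ∈ Ω, A.act g⁻¹ (A.act g (x, f x)) = (x, f x) := fun x hx => by
      have hM := (A.domain_subset (hd x hx)).2
      rw [A.act_act g⁻¹ g _ (hd x hx) (A.inv_mem _ _ (hd x hx))
        (by rw [inv_mul_cancel]; exact A.one_mem _ hM), inv_mul_cancel, A.one_act _ hM]
    have := hinv x hx
    rw [hact, hinv y hy] at this
    exact (congrArg Prod.fst this).symm
  · intro x hx
    exact (hasFDerivAt_fst_graph ((A.contDiffAt_act (hd x hx)).differentiableAt (by simp))
      ((hfx x hx).differentiableAt (by simp))).hasFDerivWithinAt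
  · intro x hx
    refine ⟨hf'.contDiffAt (hΩ'.mem_nhds (hmem x hx).1), ?_⟩
    filter_upwards [hΩ.mem_nhds hx] with y hy
    exact (hmem y hy).2

/-- After the change of variables the two integrands agree pointwise, which settles integrability
and the values at once. -/
theorem LocallyInvariant.isVariationalSymmetry {L : JetSpace p q n → ℝ}
    {A : LocalTransformationGroup d G M} (hA : A.LocallyInvariant L)
    (hn : 1 ≤ n) (hM : IsOpen M) (Ω₀ : Set (IndepVar p)) :
    A.IsVariationalSymmetry Ω₀ L := by
  intro Ω f g Ω' f' hΩ _ _ hf hgraph htr _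
  obtain ⟨himg, hinj, hder, hgerm⟩ := htr.changeOfVariables hΩ hf
  have key : ∀ x ∈ Ω, |(totalJacobian (A.act g) (x, f x) (fderiv ℝ f x)).det| •
      L ((A.act g (x, f x)).1, prolongFun n f' (A.act g (x, f x)).1) =
      L (x, prolongFun n f x) := by
    intro x hx
    have hfx : ContDiffAt ℝ ∞ f x := hf.contDiffAt (hΩ.mem_nhds hx)
    have hg := htr.1 x hx
    obtain ⟨hd, hdet⟩ := connectedComponentIn_subset _ _ hg
    have hz : ((x, prolongFun n f x) : JetSpace p q n) ∈ jetSet n M := by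
      rw [jetSet, mem_ofPred_eq, base_prolongFun]
      exact hgraph (mem_image_of_mem _ hx)
    have hfd := (sameJet_taylorFun (n := n) hfx).fderiv_eq hn
    have := hA.pullbackLagrangian_eq hn hM hz (g := g)
      (by rw [base_prolongFun, hfd]; exact hg)
    rw [pullbackLagrangian, jetJacobian_prolongFun hn _ hfx,
      prolongMap_eq hn (hgerm x hx) (A.contDiffAt_act hd) hfx hdet] at this
    rw [abs_of_pos this.2, smul_eq_mul, mul_comm]
    exact this.1
  rw [← himg]
  constructor
  · rw [integrableOn_image_iff_integrableOn_abs_det_fderiv_smul volume hΩ.measurableSet hder hinj]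
    exact integrableOn_congr_fun key hΩ.measurableSet
  · rw [integral_image_eq_integral_abs_det_fderiv_smul volume hΩ.measurableSet hder hinj]
    exact setIntegral_congr_fun hΩ.measurableSet key

end LocalTransformationGroup

end VarSym

/-! ### From invariance of the integral to local invariance -/

namespace VarSym

variable {p q n d : ℕ}

/-- Continuous functions with the same integrals over small balls around a point agree there. -/
theorem eq_of_setIntegral_ball_eq {F H : IndepVar p → ℝ} {s : Set (IndepVar p)} (hs : IsOpen s)
    {x : IndepVar p} (hx : x ∈ s) (hF : ContinuousOn F s) (hH : ContinuousOn H s)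
    (h : ∀ r > 0, Metric.closedBall x r ⊆ s →
      ∫ y in Metric.ball x r, F y = ∫ y in Metric.ball x r, H y) : F x = H x := by
  have hc : ContinuousAt (fun y => F y - H y) x :=
    (hF.continuousAt (hs.mem_nhds hx)).sub (hH.continuousAt (hs.mem_nhds hx))
  rw [← sub_eq_zero, ← abs_eq_zero]
  refine le_antisymm (le_of_forall_pos_le_add fun ε hε => ?_) (abs_nonneg _)
  obtain ⟨r₁, hr₁, hb₁⟩ := Metric.nhds_basis_closedBall.mem_iff.1 (hs.mem_nhds hx)
  obtain ⟨r₂, hr₂, hb₂⟩ := Metric.continuousAt_iff.1 hc ε hε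
  set r := min r₁ r₂ with hr
  have hr0 : 0 < r := lt_min hr₁ hr₂
  have hsub : Metric.closedBall x r ⊆ s :=
    (Metric.closedBall_subset_closedBall (min_le_left _ _)).trans hb₁
  have hint : ∀ {K : IndepVar p → ℝ}, ContinuousOn K s → IntegrableOn K (Metric.ball x r) :=
    fun hK => ((hK.mono hsub).integrableOn_compact (isCompact_closedBall x r)).mono_set
      Metric.ball_subset_closedBall
  have hvol : volume (Metric.ball x r) < ⊤ := measure_ball_lt_top
  have hpos : 0 < volume.real (Metric.ball x r) :=
    ENNReal.toReal_pos (Metric.measure_ball_pos volume x hr0).ne' hvol.ne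
  -- Since the integrals of `F` and `H` cancel, only the constant `F x - H x` is left; by continuity
  -- the integrand is at most `ε` in absolute value.
  have h1 : ∫ y in Metric.ball x r, ((F y - H y) - (F x - H x)) =
      - ((F x - H x) * volume.real (Metric.ball x r)) := by
    rw [integral_sub (hint (hF.fun_sub hH)) (integrableOn_const hvol.ne),
      integral_sub (hint hF) (hint hH), h r hr0 hsub, setIntegral_const]
    simp [mul_comm]
  have h2 : ‖∫ y in Metric.ball x r, ((F y - H y) - (F x - H x))‖ ≤
      ε * volume.real (Metric.ball x r) := by
    refine norm_setIntegral_le_of_norm_le_const hvol fun y hy => ?_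
    have := hb₂ (lt_of_lt_of_le hy (min_le_right _ _))
    rw [Real.dist_eq] at this
    exact this.le
  rw [h1, norm_neg, norm_mul, Real.norm_eq_abs, Real.norm_of_nonneg hpos.le] at h2
  simpa using le_of_mul_le_mul_right h2 hpos

namespace LocalTransformationGroup

variable {G : Type*} [TopologicalSpace G] [ChartedSpace (EuclideanSpace ℝ (Fin d)) G]
  [Group G] [LieGroup (𝓡 d) ∞ G] {M : Set (TotalSpace p q)}
  (A : LocalTransformationGroup d G M)

/-- Near the identity, the prolongation is defined along a smooth function, locally uniformly. -/
theorem eventually_mem_prolongedDomain (hM : IsOpen M) {f : IndepVar p → DepVar q}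
    (hf : ContDiff ℝ ∞ f) {x : IndepVar p} (hx : (x, f x) ∈ M) :
    ∀ᶠ g in 𝓝 (1 : G), ∀ᶠ y in 𝓝 x, g ∈ A.prolongedDomain (y, f y) (fderiv ℝ f y) := by
  rw [eventually_nhds_one_iff (d := d)]
  have hgraph : Continuous fun y => (y, f y) := by
    have := hf.continuous
    fun_prop
  have h1 : ∀ᶠ b in 𝓝 (coordOne d G, x), (b.1, (b.2, f b.2)) ∈ A.coordDomain := by
    have hc : ContinuousAt (fun b : EuclideanSpace ℝ (Fin d) × IndepVar p => (b.1, (b.2, f b.2)))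
        (coordOne d G, x) :=
      continuousAt_fst.prodMk (hgraph.continuousAt.comp continuousAt_snd)
    exact hc.eventually (A.isOpen_coordDomain.mem_nhds (A.coordOne_mem_coordDomain hx))
  have h2 : ∀ᶠ b in 𝓝 (coordOne d G, x),
      (totalJacobian (A.coordAct b.1) (b.2, f b.2) (fderiv ℝ f b.2)).det ≠ 0 := by
    have hB := (A.contDiffAt_coordAct (A.coordOne_mem_coordDomain hx)).fst
    have hJ : ContDiffAt ℝ ∞ (fun b : EuclideanSpace ℝ (Fin d) × IndepVar p =>
        fderiv ℝ (fun m => (A.coordAct b.1 m).1) (b.2, f b.2)) (coordOne d G, x) := by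
      refine ContDiffAt.fderiv (n := ∞)
        (f := fun (b : EuclideanSpace ℝ (Fin d) × IndepVar p) m => (A.coordAct b.1 m).1)
        (g := fun b => (b.2, f b.2)) ?_
        (contDiffAt_snd.prodMk (hf.contDiffAt.comp _ contDiffAt_snd)) (by simp)
      exact ContDiffAt.comp (g := fun y : EuclideanSpace ℝ (Fin d) × TotalSpace p q =>
        (A.coordAct y.1 y.2).1) ((coordOne d G, x), (x, f x)) hB
        (contDiffAt_fst.fst.prodMk contDiffAt_snd)
    have hdf : Continuous (fderiv ℝ f) := hf.continuous_fderiv (by simp)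
    have hc : ContinuousAt (fun b : EuclideanSpace ℝ (Fin d) × IndepVar p =>
        totalJacobian (A.coordAct b.1) (b.2, f b.2) (fderiv ℝ f b.2)) (coordOne d G, x) := by
      refine hJ.continuousAt.clm_comp ?_
      have : Continuous fun b : EuclideanSpace ℝ (Fin d) × IndepVar p =>
          (ContinuousLinearMap.id ℝ (IndepVar p)).prod (fderiv ℝ f b.2) := by
        have h := (ContinuousLinearMap.prodₗᵢ ℝ (𝕜 := ℝ) (E := IndepVar p) (F := IndepVar p)
          (G := DepVar q)).continuous
        exact h.comp (continuous_const.prodMk (hdf.comp continuous_snd))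
      exact this.continuousAt
    refine (contDiff_det.continuous.continuousAt.comp hc).eventually_ne ?_
    have := (A.eventually_det_pos hM hx (fderiv ℝ f x)).self_of_nhds.ne'
    simpa only [coordAct_coordOne_eq, Function.comp_apply] using this
  obtain ⟨ε, hε, hball⟩ := Metric.eventually_nhds_iff_ball.1 (h1.and h2)
  filter_upwards [Metric.ball_mem_nhds (coordOne d G) hε] with a ha
  filter_upwards [Metric.ball_mem_nhds x hε] with y hy
  have hsub : ofCoord d G '' Metric.ball (coordOne d G) ε ⊆
      {g : G | (g, (y, f y)) ∈ A.domain ∧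
        (totalJacobian (A.act g) (y, f y) (fderiv ℝ f y)).det ≠ 0} := by
    rintro _ ⟨b, hb, rfl⟩
    have := hball (b, y) (by rw [← ball_prod_same]; exact ⟨hb, hy⟩)
    exact ⟨this.1.2, this.2⟩
  -- The coordinate ball gives a connected set of admissible group elements through the identity,
  -- which therefore lies in the component; the same ball serves all `y` near `x`.
  have hconn : IsPreconnected (ofCoord d G '' Metric.ball (coordOne d G) ε) := by
    refine (convex_ball _ _).isPreconnected.image _ fun b hb => ?_
    have := hball (b, x) (by rw [← ball_prod_same]; exact ⟨hb, Metric.mem_ball_self hε⟩)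
    exact (continuousAt_ofCoord this.1.1).continuousWithinAt
  exact hconn.subset_connectedComponentIn
    ⟨coordOne d G, Metric.mem_ball_self hε, ofCoord_coordOne⟩ hsub (mem_image_of_mem _ ha)

/-- The symmetry condition is tested on one representative `f` of the jet over shrinking balls
around `x`; the inverse function theorem supplies a single transform `f'` valid for all of them. -/
theorem IsVariationalSymmetry.locallyInvariant {A : LocalTransformationGroup d G M}
    {Ω₀ : Set (IndepVar p)} {L : JetSpace p q n → ℝ} (hA : A.IsVariationalSymmetry Ω₀ L)
    (hn : 1 ≤ n) (hM : IsOpen M) (hMΩ₀ : M ⊆ Ω₀ ×ˢ univ)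
    (hL : ContDiffOn ℝ ∞ L (jetSet n M)) : A.LocallyInvariant L := by
  intro z hz
  obtain ⟨x, u⟩ := z
  obtain ⟨f, hf, hu⟩ : ∃ f : IndepVar p → DepVar q, ContDiff ℝ ∞ f ∧ u = prolongFun n f x :=
    ⟨taylorFun ((x, u) : JetSpace p q n), contDiff_taylorFun _,
      (prolongFun_taylorFun ((x, u) : JetSpace p q n)).symm⟩
  subst hu
  have hx : (x, f x) ∈ M := by
    rw [← base_prolongFun (n := n) f x]
    exact hz
  filter_upwards [A.eventually_mem_prolongedDomain hM hf hx,
    A.eventually_det_pos hM hx (fderiv ℝ f x)] with g hg hdet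
  obtain ⟨δ, hδ, hgδ⟩ := Metric.eventually_nhds_iff_ball.1 hg
  have hdom : ∀ y ∈ Metric.ball x δ, (g, (y, f y)) ∈ A.domain := fun y hy =>
    (connectedComponentIn_subset _ _ (hgδ y hy)).1
  set H : IndepVar p → IndepVar p := fun y => (A.act g (y, f y)).1 with hHdef
  have hgr : ContDiffOn ℝ ∞ (fun y => A.act g (y, f y)) (Metric.ball x δ) := fun y hy =>
    (contDiffAt_graph (A.contDiffAt_act (hdom y hy)) hf.contDiffAt).contDiffWithinAt
  have hderiv : ∀ y ∈ Metric.ball x δ,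
      HasFDerivAt H (totalJacobian (A.act g) (y, f y) (fderiv ℝ f y)) y := fun y hy =>
    hasFDerivAt_fst_graph ((A.contDiffAt_act (hdom y hy)).differentiableAt (by simp))
      (hf.contDiffAt.differentiableAt (by simp))
  have hxδ := Metric.mem_ball_self (x := x) hδ
  obtain ⟨e, hxe, heδ, heH, hesymm⟩ := exists_openPartialHomeomorph Metric.isOpen_ball hgr.fst hxδ
    (by
      have := (hderiv x hxδ).fderiv
      simp only [hHdef] at this
      rw [this]
      exact isInvertible_of_det_ne_zero hdet.ne')
  change ⇑e = H at heH
  let f' : IndepVar p → DepVar q := fun y => (A.act g (e.symm y, f (e.symm y))).2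
  have hf' : ContDiffOn ℝ ∞ f' e.target :=
    (hgr.comp hesymm fun y hy => heδ (e.map_target hy)).snd
  have hleft : ∀ y ∈ e.source, e.symm (H y) = y := fun y hy => heH ▸ e.left_inv hy
  have hmaps : ∀ y ∈ e.source, H y ∈ e.target := fun y hy => heH ▸ e.map_source hy
  have hf'H : ∀ y ∈ e.source, (H y, f' (H y)) = A.act g (y, f y) := fun y hy => by
    simp only [f', hleft y hy]
    rfl
  have hsΩ₀ : e.source ⊆ Ω₀ := fun y hy =>
    (hMΩ₀ (A.domain_subset (hdom y (heδ hy))).2).1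
  have htr : ∀ Ω ⊆ e.source, IsOpen Ω → A.IsTransform g Ω f (H '' Ω) f' := by
    intro Ω hΩ hΩo
    refine ⟨fun y hy => hgδ y (heδ (hΩ hy)), ?_, ?_, ?_⟩
    · rw [← heH]
      exact e.isOpen_image_of_subset_source hΩo hΩ
    · exact hf'.mono (image_subset_iff.2 fun y hy => hmaps y (hΩ hy))
    · rw [graphOn, graphOn, image_image, image_image]
      exact image_congr fun y hy => (hf'H y (hΩ hy)).symm
  have hgerm := ((htr e.source subset_rfl e.open_source).changeOfVariables e.open_source
    hf.contDiffOn).2.2.2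
  have hLc : ContinuousOn L (jetSet n M) := hL.continuousOn
  have hjet : ∀ {k : IndepVar p → DepVar q} {s : Set (IndepVar p)}, IsOpen s →
      ContDiffOn ℝ ∞ k s → ContinuousOn (fun y => (y, prolongFun n k y)) s := fun hs hk y hy =>
    (continuousAt_id.prodMk
      (contDiffAt_prolongFun (hk.contDiffAt (hs.mem_nhds hy))).continuousAt).continuousWithinAt
  have hcont₁ : ContinuousOn (fun y => L (y, prolongFun n f y)) e.source := by
    refine hLc.comp (hjet e.open_source hf.contDiffOn) fun y hy => ?_
    rw [jetSet, mem_ofPred_eq, base_prolongFun]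
    exact (A.domain_subset (hdom y (heδ hy))).2
  have hHc : ContDiffOn ℝ ∞ H e.source := hgr.fst.mono heδ
  have hcont₂ : ContinuousOn (fun y => |(fderiv ℝ H y).det| • L (H y, prolongFun n f' (H y)))
      e.source := by
    simp only [smul_eq_mul]
    refine ContinuousOn.mul ?_ ?_
    · exact (contDiff_det.continuous.comp_continuousOn
        (hHc.continuousOn_fderiv_of_isOpen e.open_source (by simp))).abs
    · refine hLc.comp ((hjet e.open_target hf').comp hHc.continuousOn hmaps) fun y hy => ?_
      rw [jetSet, mem_ofPred_eq, base_prolongFun, hf'H y hy]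
      exact A.act_mem _ _ (hdom y (heδ hy))
  -- Closed balls inside `e.source` are needed because the domain of integration must have its
  -- closure in `Ω₀`.
  have key := eq_of_setIntegral_ball_eq e.open_source hxe hcont₂ hcont₁ fun r hr hball => by
    have hsub : Metric.ball x r ⊆ e.source := Metric.ball_subset_closedBall.trans hball
    have htr' := htr _ hsub Metric.isOpen_ball
    have := (hA (Metric.ball x r) f g _ f' Metric.isOpen_ball
      ((convex_ball x r).isConnected (Metric.nonempty_ball.2 hr))
      ((Metric.closure_ball_subset_closedBall.trans hball).trans hsΩ₀) hf.contDiffOn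
      (by
        rintro _ ⟨y, hy, rfl⟩
        exact (A.domain_subset (hdom y (heδ (hsub hy)))).2)
      htr'
      (by
        rintro _ ⟨y, hy, rfl⟩
        exact (hMΩ₀ (A.act_mem _ _ (hdom y (heδ (hsub hy))))).1)).2
    obtain ⟨himg, hinj, hder, -⟩ := htr'.changeOfVariables Metric.isOpen_ball hf.contDiffOn
    rw [← this, integral_image_eq_integral_abs_det_fderiv_smul volume measurableSet_ball hder hinj]
    refine setIntegral_congr_fun measurableSet_ball fun y hy => ?_
    rw [(hderiv y (heδ (hsub hy))).fderiv]
  rw [pullbackLagrangian, jetJacobian_prolongFun hn _ hf.contDiffAt,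
    prolongMap_eq hn (hgerm x hxe) (A.contDiffAt_act (hdom x hxδ)) hf.contDiffAt hdet.ne', ← key,
    (hderiv x hxδ).fderiv, abs_of_pos hdet, smul_eq_mul, mul_comm]

end LocalTransformationGroup

end VarSym

namespace VarSym

/-! ### Uniqueness of integral curves -/

section Uniqueness

variable {V : Type*} [NormedAddCommGroup V] [NormedSpace ℝ V] {v : V → V} {M : Set V}

/-- The set of agreement is closed and, by local uniqueness, can be continued to the right. It
suffices that `γ₁` stays in `M`: at a time of agreement `γ₂` is at the same point, where `v` is
locally Lipschitz. -/
theorem eqOn_Icc_of_hasDerivWithinAt (hv : ∀ m ∈ M, ContDiffAt ℝ 1 v m) {b : ℝ} {γ₁ γ₂ : ℝ → V}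
    (h₁ : ∀ t ∈ Icc 0 b, HasDerivWithinAt γ₁ (v (γ₁ t)) (Icc 0 b) t)
    (h₂ : ∀ t ∈ Icc 0 b, HasDerivWithinAt γ₂ (v (γ₂ t)) (Icc 0 b) t)
    (hM : MapsTo γ₁ (Icc 0 b) M) (h0 : γ₁ 0 = γ₂ 0) :
    EqOn γ₁ γ₂ (Icc 0 b) := by
  have hc₁ : ContinuousOn γ₁ (Icc 0 b) := fun t ht => (h₁ t ht).continuousWithinAt
  have hc₂ : ContinuousOn γ₂ (Icc 0 b) := fun t ht => (h₂ t ht).continuousWithinAt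
  refine IsClosed.Icc_subset_of_forall_exists_gt (s := {t | γ₁ t = γ₂ t}) ?_ h0 ?_
  · have := (hc₁.sub hc₂).preimage_isClosed_of_isClosed isClosed_Icc (isClosed_singleton (x := 0))
    convert this using 1
    ext t
    simp [sub_eq_zero, and_comm]
  · rintro t ⟨hte, ht⟩ y hy
    have hte : γ₁ t = γ₂ t := hte
    have ht' : t ∈ Icc 0 b := Ico_subset_Icc_self ht
    obtain ⟨K, U, hU, hK⟩ := (hv _ (hM ht')).exists_lipschitzOnWith
    have hge : 𝓝[≥] t ≤ 𝓝[Icc 0 b] t := by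
      have h : Icc t b ∈ 𝓝[≥] t := Icc_mem_nhdsGE ht.2
      exact nhdsWithin_le_iff.2 (Filter.mem_of_superset h (Icc_subset_Icc_left ht.1))
    have hev : ∀ᶠ s in 𝓝[≥] t, γ₁ s ∈ U ∧ γ₂ s ∈ U :=
      hge (((hc₁ t ht').eventually hU).and ((hc₂ t ht').eventually (hte ▸ hU)))
    obtain ⟨u, htu, hu⟩ := mem_nhdsGE_iff_exists_Icc_subset.1 hev
    set c := min u (min y b) with hc
    have htc : t < c := lt_min htu (lt_min hy ht.2)
    have hcb : c ≤ b := (min_le_right _ _).trans (min_le_right _ _)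
    have hsub : Icc t c ⊆ Icc 0 b := Icc_subset_Icc ht.1 hcb
    have hd : ∀ {γ : ℝ → V}, (∀ t ∈ Icc 0 b, HasDerivWithinAt γ (v (γ t)) (Icc 0 b) t) →
        ∀ s ∈ Ico t c, HasDerivWithinAt γ (v (γ s)) (Ici s) s := fun hγ s hs => by
      refine (hγ s (hsub (Ico_subset_Icc_self hs))).mono_of_mem_nhdsWithin ?_
      exact Filter.mem_of_superset (Icc_mem_nhdsGE (hs.2.trans_le hcb))
        (Icc_subset_Icc_left (ht.1.trans hs.1))
    have huc : ∀ s ∈ Ico t c, γ₁ s ∈ U ∧ γ₂ s ∈ U := fun s hs =>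
      hu ⟨hs.1, hs.2.le.trans (min_le_left _ _)⟩
    have := ODE_solution_unique_of_mem_Icc_right (v := fun _ => v) (s := fun _ => U) (K := K)
      (fun _ _ => hK) (hc₁.mono hsub) (hd h₁) (fun s hs => (huc s hs).1) (hc₂.mono hsub) (hd h₂)
      (fun s hs => (huc s hs).2) hte
    exact ⟨c, this (right_mem_Icc.2 htc.le), htc, (min_le_right _ _).trans (min_le_left _ _)⟩

/-- Negative times are reduced to positive ones by reversing time and replacing `v` by `-v`. -/
theorem eq_of_isIntegralCurveOn (hv : ∀ m ∈ M, ContDiffAt ℝ 1 v m) {ε : ℝ} {γ₁ γ₂ : ℝ → V}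
    (h₁ : IsIntegralCurveOn γ₁ (fun _ => v) (uIcc 0 ε))
    (h₂ : IsIntegralCurveOn γ₂ (fun _ => v) (uIcc 0 ε))
    (hM : MapsTo γ₁ (uIcc 0 ε) M) (h0 : γ₁ 0 = γ₂ 0) : γ₁ ε = γ₂ ε := by
  rcases le_total 0 ε with hε | hε
  · rw [uIcc_of_le hε] at h₁ h₂ hM
    exact eqOn_Icc_of_hasDerivWithinAt hv h₁ h₂ hM h0 (right_mem_Icc.2 hε)
  · rw [uIcc_of_ge hε] at h₁ h₂ hM
    have hneg : MapsTo (fun t : ℝ => -t) (Icc 0 (-ε)) (Icc ε 0) := fun t ht =>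
      ⟨by linarith [ht.2], by linarith [ht.1]⟩
    have hd : ∀ {γ : ℝ → V}, IsIntegralCurveOn γ (fun _ => v) (Icc ε 0) →
        ∀ t ∈ Icc 0 (-ε), HasDerivWithinAt (fun t => γ (-t)) ((fun m => - v m) (γ (-t)))
          (Icc 0 (-ε)) t := fun hγ t ht => by
      have := HasDerivWithinAt.scomp t (hγ (-t) (hneg ht)) ((hasDerivWithinAt_id t _).neg) hneg
      simpa [Function.comp_def] using this
    have := eqOn_Icc_of_hasDerivWithinAt (fun m hm => (hv m hm).neg) (hd h₁) (hd h₂)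
      (hM.comp hneg) (by simpa using h0) (right_mem_Icc.2 (by linarith : (0 : ℝ) ≤ -ε))
    simpa using this

end Uniqueness

/-! ### Symmetry of mixed partial derivatives -/

section Symmetry

variable {E V W : Type*} [NormedAddCommGroup E] [NormedSpace ℝ E] [NormedAddCommGroup V]
  [NormedSpace ℝ V] [NormedAddCommGroup W] [NormedSpace ℝ W]

/-- Mixed partial derivatives commute. -/
theorem fderiv_fderiv_comm {Ψ : E × V → W} {a : E} {m : V} (h : ContDiffAt ℝ 2 Ψ (a, m)) (w : E)
    (y : V) :
    fderiv ℝ (fun b => fderiv ℝ (fun m' => Ψ (b, m')) m) a w y =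
      fderiv ℝ (fun m' => fderiv ℝ (fun b => Ψ (b, m')) a w) m y := by
  have hev : ∀ᶠ u in 𝓝 (a, m), DifferentiableAt ℝ Ψ u :=
    (h.eventually (by simp)).mono fun u hu => hu.differentiableAt (by simp)
  have hd : HasFDerivAt (fderiv ℝ Ψ) (fderiv ℝ (fderiv ℝ Ψ) (a, m)) (a, m) :=
    ((h.fderiv_right (m := 1) (by norm_num)).differentiableAt (by simp)).hasFDerivAt
  -- Both sides are values of the second derivative of `Ψ` on `(w, 0)` and `(0, y)`, in opposite
  -- orders.
  have h1 : (fun b => fderiv ℝ (fun m' => Ψ (b, m')) m) =ᶠ[𝓝 a]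
      fun b => (fderiv ℝ Ψ (b, m)).comp (ContinuousLinearMap.inr ℝ E V) := by
    have hc : ContinuousAt (fun b : E => (b, m)) a := by fun_prop
    filter_upwards [hc.eventually hev] with b hb
    exact (HasFDerivAt.comp m hb.hasFDerivAt (hasFDerivAt_prodMk_right b m)).fderiv
  have h2 : (fun m' => fderiv ℝ (fun b => Ψ (b, m')) a w) =ᶠ[𝓝 m]
      fun m' => fderiv ℝ Ψ (a, m') (w, 0) := by
    have hc : ContinuousAt (fun m' : V => (a, m')) m := by fun_prop
    filter_upwards [hc.eventually hev] with m' hm'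
    have := (HasFDerivAt.comp (g := Ψ) (f := fun b => (b, m')) a hm'.hasFDerivAt
      (hasFDerivAt_prodMk_left a m')).fderiv
    simp only [Function.comp_def] at this
    simp [this]
  rw [h1.fderiv_eq, h2.fderiv_eq]
  have h3 := HasFDerivAt.comp (g := fderiv ℝ Ψ) (f := fun b => (b, m)) a hd
    (hasFDerivAt_prodMk_left a m)
  have h4 := HasFDerivAt.comp (g := fderiv ℝ Ψ) (f := fun m' => (a, m')) m hd
    (hasFDerivAt_prodMk_right a m)
  have h5 := h3.clm_comp (hasFDerivAt_const (ContinuousLinearMap.inr ℝ E V) a)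
  have h6 := h4.clm_apply (hasFDerivAt_const ((w, 0) : E × V) m)
  have e5 := h5.fderiv
  have e6 := h6.fderiv
  simp only [Function.comp_def] at e5 e6
  rw [e5, e6]
  have := h.isSymmSndFDerivAt (by simp) (w, 0) (0, y)
  simpa using this

end Symmetry

end VarSym

namespace VarSym

namespace LocalTransformationGroup

variable {p q n d : ℕ} {G : Type*} [TopologicalSpace G] [ChartedSpace (EuclideanSpace ℝ (Fin d)) G]
  [Group G] [LieGroup (𝓡 d) ∞ G] {M : Set (TotalSpace p q)}
  (A : LocalTransformationGroup d G M)

/-! ### The flow of an infinitesimal generator -/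

variable (G) in
/-- The right invariant vector field defined by `w`, in coordinates near the identity. -/
def coordField (w a : EuclideanSpace ℝ (Fin d)) : EuclideanSpace ℝ (Fin d) :=
  fderiv ℝ (coordMul d G) (coordOne d G, a) (w, 0)

theorem contDiffAt_coordField (w : EuclideanSpace ℝ (Fin d)) :
    ContDiffAt ℝ ∞ (coordField G w) (coordOne d G) := by
  have h : ContDiffAt ℝ ∞ (fderiv ℝ (coordMul d G)) (coordOne d G, coordOne d G) :=
    contDiffAt_coordMul.fderiv_right (by simp)
  exact (ContDiffAt.comp (coordOne d G) h (contDiffAt_const.prodMk contDiffAt_id)).clm_apply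
    contDiffAt_const

theorem coordField_coordOne (w : EuclideanSpace ℝ (Fin d)) :
    coordField G w (coordOne d G) = w := by
  have h1 : HasFDerivAt (coordMul d G) _ (coordOne d G, coordOne d G) :=
    (contDiffAt_coordMul.differentiableAt (by simp)).hasFDerivAt
  have h2 := HasFDerivAt.comp (f := fun a => (a, coordOne d G)) (coordOne d G) h1
    (hasFDerivAt_prodMk_left _ _)
  have h3 : HasFDerivAt (coordMul d G ∘ fun a => (a, coordOne d G))
      (ContinuousLinearMap.id ℝ _) (coordOne d G) := by
    refine (hasFDerivAt_id _).congr_of_eventuallyEq ?_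
    filter_upwards [target_mem_nhds] with a ha
    exact coordMul_coordOne_right ha
  have := congrArg (fun D => D w) (h2.unique h3)
  simpa [coordField] using this

theorem hasFDerivAt_coordMul_left {b : EuclideanSpace ℝ (Fin d)}
    (hb : DifferentiableAt ℝ (coordMul d G) (coordOne d G, b)) :
    HasFDerivAt (fun a => coordMul d G (a, b))
      ((fderiv ℝ (coordMul d G) (coordOne d G, b)).comp (ContinuousLinearMap.inl ℝ _ _))
      (coordOne d G) :=
  HasFDerivAt.comp (f := fun a => (a, b)) (coordOne d G) hb.hasFDerivAt
    (hasFDerivAt_prodMk_left _ _)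

theorem eventually_differentiableAt_coordMul :
    ∀ᶠ b in 𝓝 (coordOne d G), DifferentiableAt ℝ (coordMul d G) (coordOne d G, b) := by
  have hc : ContinuousAt (fun b => (coordOne d G, b)) (coordOne d G) := by fun_prop
  refine hc.eventually (((contDiffAt_coordMul (d := d) (G := G)).of_le
    (m := 1) (by simp)).eventually (by simp)) |>.mono fun b hb => hb.differentiableAt (by simp)

theorem differentiableAt_coordAct_left {a : EuclideanSpace ℝ (Fin d)} {m : TotalSpace p q}
    (h : (a, m) ∈ A.coordDomain) : DifferentiableAt ℝ (fun b => A.coordAct b m) a :=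
  (ContDiffAt.comp (g := fun y : EuclideanSpace ℝ (Fin d) × TotalSpace p q => A.coordAct y.1 y.2) a
    (A.contDiffAt_coordAct h) (contDiffAt_id.prodMk contDiffAt_const)).differentiableAt (by simp)

theorem contDiffAt_generator (hM : IsOpen M) (w : EuclideanSpace ℝ (Fin d)) {m : TotalSpace p q}
    (hm : m ∈ M) : ContDiffAt ℝ ∞ (A.generator w) m := by
  have h : ContDiffAt ℝ ∞ (fun m => fderiv ℝ (fun a => A.coordAct a m) (coordOne d G)) m := by
    refine ContDiffAt.fderiv (n := ∞) (f := fun m a => A.coordAct a m)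
      (g := fun _ => coordOne d G) ?_ contDiffAt_const (by simp)
    exact ContDiffAt.comp (g := fun y : EuclideanSpace ℝ (Fin d) × TotalSpace p q =>
      A.coordAct y.1 y.2) (m, coordOne d G)
      (A.contDiffAt_coordAct (A.coordOne_mem_coordDomain hm))
      (contDiffAt_snd.prodMk contDiffAt_fst)
  have h' : ContDiffAt ℝ ∞
      (fun m => fderiv ℝ (fun a => A.coordAct a m) (coordOne d G) w) m :=
    h.clm_apply contDiffAt_const
  refine h'.congr_of_eventuallyEq ?_
  filter_upwards [hM.mem_nhds hm] with m' hm'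
  exact A.generator_eq w hm'

/-- The action in coordinates is compatible with the multiplication in coordinates. -/
theorem eventually_coordAct_coordMul {m : TotalSpace p q} (hm : m ∈ M) :
    ∀ᶠ y in 𝓝 ((coordOne d G, m), coordOne d G),
      A.coordAct y.2 (A.coordAct y.1.1 y.1.2) =
        A.coordAct (coordMul d G (y.2, y.1.1)) y.1.2 := by
  have hmul : ContinuousAt (fun y : (EuclideanSpace ℝ (Fin d) × TotalSpace p q) ×
      EuclideanSpace ℝ (Fin d) => coordMul d G (y.2, y.1.1)) ((coordOne d G, m), coordOne d G) :=
    ContinuousAt.comp (g := coordMul d G) contDiffAt_coordMul.continuousAt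
      (continuousAt_snd.prodMk continuousAt_fst.fst)
  have hswap : ContinuousAt (fun y : (EuclideanSpace ℝ (Fin d) × TotalSpace p q) ×
      EuclideanSpace ℝ (Fin d) => (y.2, y.1.1)) ((coordOne d G, m), coordOne d G) := by fun_prop
  have h1 : ∀ᶠ y in 𝓝 ((coordOne d G, m), coordOne d G), y.1 ∈ A.coordDomain :=
    continuousAt_fst.eventually
      (A.isOpen_coordDomain.mem_nhds (A.coordOne_mem_coordDomain hm))
  have h2 : ∀ᶠ y in 𝓝 ((coordOne d G, m), coordOne d G),
      (y.2, A.coordAct y.1.1 y.1.2) ∈ A.coordDomain := by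
    have hB := (A.contDiffAt_coordAct (A.coordOne_mem_coordDomain hm)).continuousAt
    have hc : ContinuousAt (fun y : (EuclideanSpace ℝ (Fin d) × TotalSpace p q) ×
        EuclideanSpace ℝ (Fin d) => (y.2, A.coordAct y.1.1 y.1.2))
        ((coordOne d G, m), coordOne d G) :=
      continuousAt_snd.prodMk (ContinuousAt.comp (g := fun y : EuclideanSpace ℝ (Fin d) ×
        TotalSpace p q => A.coordAct y.1 y.2) hB continuousAt_fst)
    refine hc.eventually (A.isOpen_coordDomain.mem_nhds ?_)
    simp only
    rw [A.coordAct_coordOne hm]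
    exact A.coordOne_mem_coordDomain hm
  have h3 : ∀ᶠ y in 𝓝 ((coordOne d G, m), coordOne d G),
      (coordMul d G (y.2, y.1.1), y.1.2) ∈ A.coordDomain := by
    refine (hmul.prodMk continuousAt_fst.snd).eventually (A.isOpen_coordDomain.mem_nhds ?_)
    simp only
    rw [coordMul_coordOne_left coordOne_mem]
    exact A.coordOne_mem_coordDomain hm
  have h4 := hswap.eventually (eventually_ofCoord_coordMul (d := d) (G := G))
  filter_upwards [h1, h2, h3, h4] with y hy1 hy2 hy3 hy4
  have hy3' := hy3.2
  simp only [hy4] at hy3'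
  have := A.act_act _ _ _ hy1.2 hy2.2 hy3'
  simp only [coordAct, hy4]
  exact this

/-- Differentiating `a · (b · m) = (a b) · m` in `a` at the identity: the orbit map `b ↦ b · m`
relates the right invariant field to the generator, so it sends integral curves to integral curves.
-/
theorem eventually_fderiv_coordAct (w : EuclideanSpace ℝ (Fin d)) {m : TotalSpace p q}
    (hm : m ∈ M) :
    ∀ᶠ y in 𝓝 (coordOne d G, m), y ∈ A.coordDomain ∧
      fderiv ℝ (fun y : EuclideanSpace ℝ (Fin d) × TotalSpace p q => A.coordAct y.1 y.2) y
        (coordField G w y.1, 0) = A.generator w (A.coordAct y.1 y.2) := by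
  have h1 := A.eventually_coordAct_coordMul hm
  rw [nhds_prod_eq] at h1
  have h2 : ∀ᶠ y in 𝓝 (coordOne d G, m),
      DifferentiableAt ℝ (coordMul d G) (coordOne d G, y.1) :=
    (continuousAt_fst (p := (coordOne d G, m))).eventually eventually_differentiableAt_coordMul
  filter_upwards [h1.curry, h2, A.isOpen_coordDomain.mem_nhds (A.coordOne_mem_coordDomain hm)]
    with y hy hy2 hyd
  obtain ⟨b, m'⟩ := y
  refine ⟨hyd, ?_⟩
  have hmem : A.coordAct b m' ∈ M := A.act_mem _ _ hyd.2
  rw [A.generator_eq w hmem]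
  have hb : coordMul d G (coordOne d G, b) = b := coordMul_coordOne_left hyd.1
  have d1 : HasFDerivAt (fun a => A.coordAct a (A.coordAct b m')) _ (coordOne d G) :=
    (A.differentiableAt_coordAct_left (A.coordOne_mem_coordDomain hmem)).hasFDerivAt
  have d2 : HasFDerivAt (fun y : EuclideanSpace ℝ (Fin d) × TotalSpace p q => A.coordAct y.1 y.2)
      (fderiv ℝ (fun y : EuclideanSpace ℝ (Fin d) × TotalSpace p q => A.coordAct y.1 y.2) (b, m'))
      (coordMul d G (coordOne d G, b), m') := by
    rw [hb]
    exact ((A.contDiffAt_coordAct hyd).differentiableAt (by simp)).hasFDerivAt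
  have d3 := HasFDerivAt.comp (f := fun a => (coordMul d G (a, b), m')) (coordOne d G) d2
    ((hasFDerivAt_coordMul_left hy2).prodMk (hasFDerivAt_const m' _))
  have := congrArg (fun D => D w) (d1.unique (d3.congr_of_eventuallyEq hy))
  simp only [coordField]
  simpa using this.symm

/-- The flow of an infinitesimal generator is given by a curve in the group. -/
theorem exists_curve_flow_eq (hM : IsOpen M) (w : EuclideanSpace ℝ (Fin d)) {m : TotalSpace p q}
    (hm : m ∈ M) :
    ∃ c : ℝ → EuclideanSpace ℝ (Fin d), c 0 = coordOne d G ∧ HasDerivAt c w 0 ∧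
      ∀ᶠ t in 𝓝 0, flow M (A.generator w) t =ᶠ[𝓝 m] A.coordAct (c t) := by
  -- Picard–Lindelöf for the right invariant field gives one curve in the group that serves all
  -- starting points near `m`.
  obtain ⟨c, hc0, ε, hε, hc⟩ :=
    ((contDiffAt_coordField (G := G) w).of_le (m := 1)
      (by simp)).exists_forall_mem_closedBall_exists_eq_forall_mem_Ioo_hasDerivAt₀ 0
  have hd0 := hc 0 (by simp [hε])
  rw [hc0, coordField_coordOne] at hd0
  refine ⟨c, hc0, hd0, ?_⟩
  have hcont : ContinuousAt (fun y : ℝ × TotalSpace p q => (c y.1, y.2)) (0, m) :=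
    (ContinuousAt.comp (g := c) (f := Prod.fst) (x := ((0 : ℝ), m)) hd0.continuousAt
      continuousAt_fst).prodMk continuousAt_snd
  have h1 := A.eventually_fderiv_coordAct w hm
  rw [← hc0] at h1
  replace h1 := hcont.eventually h1
  have h2 : ∀ᶠ y : ℝ × TotalSpace p q in 𝓝 (0, m), HasDerivAt c (coordField G w (c y.1)) y.1 := by
    refine continuousAt_fst.eventually (Filter.mem_of_superset
      (Ioo_mem_nhds (by linarith : (0 : ℝ) - ε < 0) (by linarith)) hc)
  have h3 : ∀ᶠ y : ℝ × TotalSpace p q in 𝓝 (0, m), y.2 ∈ M :=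
    continuousAt_snd.eventually (hM.mem_nhds hm)
  obtain ⟨δ, hδ, hball⟩ := Metric.eventually_nhds_iff_ball.1 (h1.and (h2.and h3))
  have hball' : ∀ t ∈ Metric.ball (0 : ℝ) δ, ∀ m' ∈ Metric.ball m δ, _ := fun t ht m' hm' =>
    hball (t, m') (by rw [← ball_prod_same]; exact ⟨ht, hm'⟩)
  filter_upwards [Metric.ball_mem_nhds (0 : ℝ) hδ] with t ht
  filter_upwards [Metric.ball_mem_nhds m hδ] with m' hm'
  have hm'M : m' ∈ M := (hball' t ht m' hm').2.2
  have hsub : uIcc 0 t ⊆ Metric.ball (0 : ℝ) δ := by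
    refine (convex_ball (0 : ℝ) δ).ordConnected.uIcc_subset (Metric.mem_ball_self hδ) ht
  have hγ : ∀ s ∈ Metric.ball (0 : ℝ) δ,
      HasDerivAt (fun s => A.coordAct (c s) m') (A.generator w (A.coordAct (c s) m')) s := by
    intro s hs
    obtain ⟨⟨hd, hder⟩, hcs, -⟩ := hball' s hs m' hm'
    have d1 : HasDerivAt (fun s => (c s, m')) (coordField G w (c s), 0) s :=
      hcs.prodMk (hasDerivAt_const s m')
    have d2 := HasFDerivAt.comp_hasDerivAt (f := fun s => (c s, m')) s
      ((A.contDiffAt_coordAct hd).differentiableAt (by simp)).hasFDerivAt d1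
    rw [hder] at d2
    exact d2
  have h0 : A.coordAct (c 0) m' = m' := by rw [hc0, A.coordAct_coordOne hm'M]
  have hmaps : MapsTo (fun s => A.coordAct (c s) m') (uIcc 0 t) M := fun s hs =>
    A.act_mem _ _ (hball' s (hsub hs) m' hm').1.1.2
  have hint : IsIntegralCurveOn (fun s => A.coordAct (c s) m') (fun _ => A.generator w)
      (uIcc 0 t) := fun s hs => (hγ s (hsub hs)).hasDerivWithinAt
  have hex : ∃ γ : ℝ → TotalSpace p q, γ 0 = m' ∧ MapsTo γ (uIcc 0 t) M ∧
      IsIntegralCurveOn γ (fun _ => A.generator w) (uIcc 0 t) :=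
    ⟨_, h0, hmaps, hint⟩
  rw [flow, dif_pos hex]
  -- The curve chosen in `flow` is unspecified, but uniqueness forces its value at time `t`.
  obtain ⟨e0, eM, eint⟩ := hex.choose_spec
  exact eq_of_isIntegralCurveOn
    (fun m hm => (A.contDiffAt_generator hM w hm).of_le (by simp)) eint hint eM (e0.trans h0.symm)

/-! ### The infinitesimal criterion -/

theorem prolongMap_act_one (hn : 1 ≤ n) (hM : IsOpen M) {z : JetSpace p q n}
    (hz : z ∈ jetSet n M) : prolongMap n (A.act 1) z = z := by
  have hz' : z.base ∈ M := hz
  have hone := A.act_one_eventuallyEq hM hz'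
  have hm : ((1 : G), z.base) ∈ A.domain := A.one_mem _ hz
  have hdet := (A.eventually_det_pos hM hz' (fderiv ℝ (taylorFun z) z.1)).self_of_nhds.ne'
  have hgerm : IsGermTransform (A.act 1) (taylorFun z) z.1 (taylorFun z) := by
    refine ⟨(contDiff_taylorFun z).contDiffAt, ?_⟩
    rw [base_eq] at hone
    have hc : ContinuousAt (fun y => (y, taylorFun z y)) z.1 :=
      continuousAt_id.prodMk (contDiff_taylorFun z).continuous.continuousAt
    filter_upwards [hc.eventually hone] with y hy
    rw [hy]
    rfl
  rw [A.prolongMap_eq_of_germ hn hm hdet hgerm, A.one_act _ hz']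
  exact (eq_prolongFun z).symm

theorem contDiffAt_prolongMap_coordAct (hn : 1 ≤ n) (hM : IsOpen M) {z : JetSpace p q n}
    (hz : z ∈ jetSet n M) :
    ContDiffAt ℝ ∞ (fun a => prolongMap n (A.coordAct a) z) (coordOne d G) := by
  refine contDiffAt_prolongMap hn A.isOpen_coordDomain A.contDiffOn_coordAct
    (A.coordOne_mem_coordDomain hz) ?_
  rw [A.coordAct_coordOne_eq]
  exact (A.eventually_det_pos hM hz _).self_of_nhds.ne'

/-- Prolongation sees only the germ of the flow, which is the action along a curve `c` with `c' 0 =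
w`; the chain rule does the rest. -/
theorem prolongField_generator (hn : 1 ≤ n) (hM : IsOpen M) (w : EuclideanSpace ℝ (Fin d))
    {z : JetSpace p q n} (hz : z ∈ jetSet n M) :
    prolongField n M (A.generator w) z =
      fderiv ℝ (fun a => prolongMap n (A.coordAct a) z) (coordOne d G) w := by
  obtain ⟨c, hc0, hc, hflow⟩ := A.exists_curve_flow_eq hM w (m := z.base) hz
  have hev : (fun t => prolongMap n (flow M (A.generator w) t) z) =ᶠ[𝓝 0]
      fun t => prolongMap n (A.coordAct (c t)) z :=
    hflow.mono fun t ht => prolongMap_congr ht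
  rw [prolongField, hev.deriv_eq]
  have h1 : HasFDerivAt (fun a => prolongMap n (A.coordAct a) z)
      (fderiv ℝ (fun a => prolongMap n (A.coordAct a) z) (coordOne d G)) (c 0) := by
    rw [hc0]
    exact ((A.contDiffAt_prolongMap_coordAct hn hM hz).differentiableAt (by simp)).hasFDerivAt
  exact (h1.comp_hasDerivAt (0 : ℝ) hc).deriv

/-- At the identity the determinant differentiates to a trace, and since mixed partials commute, the
group derivative of `D_i Ξ^i` is `D_i ξ^i`. -/
theorem fderiv_det_jetJacobian (hn : 1 ≤ n) (hM : IsOpen M) (w : EuclideanSpace ℝ (Fin d))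
    {z : JetSpace p q n} (hz : z ∈ jetSet n M) :
    fderiv ℝ (fun a => (jetJacobian (A.coordAct a) z).det) (coordOne d G) w =
      totalDiv hn (fun m => (A.generator w m).1) z := by
  have hz' : z.base ∈ M := hz
  have hB := A.contDiffAt_coordAct (A.coordOne_mem_coordDomain hz')
  set U : IndepVar p →L[ℝ] TotalSpace p q :=
    (ContinuousLinearMap.id ℝ (IndepVar p)).prod (fderiv ℝ (taylorFun z) z.1) with hU
  have hd1 : DifferentiableAt ℝ
      (fun a => fderiv ℝ (fun m => (A.coordAct a m).1) z.base) (coordOne d G) :=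
    (ContDiffAt.fderiv (n := ∞) (m := 1) (f := fun a m => (A.coordAct a m).1)
      (g := fun _ => z.base) hB.fst contDiffAt_const (by norm_cast)).differentiableAt (by simp)
  have hJ := hd1.hasFDerivAt.clm_comp (hasFDerivAt_const U (coordOne d G))
  have hJ1 : (fderiv ℝ (fun m => (A.coordAct (coordOne d G) m).1) z.base).comp U =
      ContinuousLinearMap.id ℝ _ := by
    rw [A.coordAct_coordOne_eq]
    exact totalJacobian_of_eventuallyEq_id (A.act_one_eventuallyEq hM hz') _
  have hdet : HasFDerivAt (fun D : IndepVar p →L[ℝ] IndepVar p => D.det)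
      (fderiv ℝ (fun D : IndepVar p →L[ℝ] IndepVar p => D.det) (ContinuousLinearMap.id ℝ _))
      ((fderiv ℝ (fun m => (A.coordAct (coordOne d G) m).1) z.base).comp U) := by
    rw [hJ1]
    exact (contDiff_det.differentiable (by simp)).differentiableAt.hasFDerivAt
  have h := (HasFDerivAt.comp (coordOne d G) hdet hJ).fderiv
  change fderiv ℝ (fun a => ((fderiv ℝ (fun m => (A.coordAct a m).1) z.base).comp U).det)
    (coordOne d G) w = _
  simp only [Function.comp_def] at h
  rw [h]
  rw [ContinuousLinearMap.comp_apply, fderiv_det_id]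
  unfold totalDiv totalDeriv
  refine Finset.sum_congr rfl fun i _ => ?_
  have hUi : U (Pi.single i 1) = (Pi.single i 1, z.first hn i) := by
    simp [hU, fderiv_taylorFun hn]
  have hcomm := fderiv_fderiv_comm (Ψ := fun y : EuclideanSpace ℝ (Fin d) × TotalSpace p q =>
    (A.coordAct y.1 y.2).1) (hB.fst.of_le
      (WithTop.coe_le_coe.2 (le_top (a := (2 : ℕ∞))))) w (Pi.single i 1, z.first hn i)
  have hgen : (fun m => (A.generator w m).1) =ᶠ[𝓝 z.base]
      fun m => fderiv ℝ (fun b => (A.coordAct b m).1) (coordOne d G) w := by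
    filter_upwards [hM.mem_nhds hz'] with m hm
    rw [A.generator_eq w hm]
    have := (A.differentiableAt_coordAct_left
      (A.coordOne_mem_coordDomain hm)).hasFDerivAt.fst.fderiv
    rw [this]
    rfl
  have hgd : DifferentiableAt ℝ (fun m => (A.generator w m).1) z.base :=
    ((A.contDiffAt_generator hM w hz').differentiableAt (by simp)).fst
  have hcomp : fderiv ℝ (fun m => (A.generator w m).1 i) z.base (Pi.single i 1, z.first hn i) =
      fderiv ℝ (fun m => (A.generator w m).1) z.base (Pi.single i 1, z.first hn i) i := by
    have := (hasFDerivAt_pi'.1 hgd.hasFDerivAt i).fderiv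
    rw [this]
    rfl
  rw [hcomp, hgen.fderiv_eq, ← hcomm]
  simp [hUi]

theorem contDiffAt_pullbackLagrangian (hn : 1 ≤ n) (hM : IsOpen M) {L : JetSpace p q n → ℝ}
    (hL : ContDiffOn ℝ ∞ L (jetSet n M)) {z : JetSpace p q n} (hz : z ∈ jetSet n M) :
    ContDiffAt ℝ ∞ (fun a => pullbackLagrangian L (A.coordAct a) z) (coordOne d G) := by
  have hbase : Continuous (JetSpace.base : JetSpace p q n → TotalSpace p q) := by
    unfold JetSpace.base
    fun_prop
  have hLz : ContDiffAt ℝ ∞ L (prolongMap n (A.coordAct (coordOne d G)) z) := by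
    rw [A.coordAct_coordOne_eq, A.prolongMap_act_one hn hM hz]
    exact hL.contDiffAt ((hM.preimage hbase).mem_nhds hz)
  refine (ContDiffAt.comp (coordOne d G) hLz (A.contDiffAt_prolongMap_coordAct hn hM hz)).mul ?_
  exact contDiff_det.contDiffAt.comp _ (contDiffAt_totalJacobian
    (A.contDiffAt_coordAct (A.coordOne_mem_coordDomain hz)) _)

/-- The derivative of the pulled back Lagrangian at the identity. -/
theorem fderiv_pullbackLagrangian (hn : 1 ≤ n) (hM : IsOpen M) {L : JetSpace p q n → ℝ}
    (hL : ContDiffOn ℝ ∞ L (jetSet n M)) (w : EuclideanSpace ℝ (Fin d)) {z : JetSpace p q n}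
    (hz : z ∈ jetSet n M) :
    fderiv ℝ (fun a => pullbackLagrangian L (A.coordAct a) z) (coordOne d G) w =
      fderiv ℝ L z (prolongField n M (A.generator w) z) +
        L z * totalDiv hn (fun m => (A.generator w m).1) z := by
  have hbase : Continuous (JetSpace.base : JetSpace p q n → TotalSpace p q) := by
    unfold JetSpace.base
    fun_prop
  have hP1 : prolongMap n (A.coordAct (coordOne d G)) z = z := by
    rw [A.coordAct_coordOne_eq, A.prolongMap_act_one hn hM hz]
  have hLz : HasFDerivAt L (fderiv ℝ L z) (prolongMap n (A.coordAct (coordOne d G)) z) := by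
    rw [hP1]
    exact ((hL.contDiffAt ((hM.preimage hbase).mem_nhds hz)).differentiableAt
      (by simp)).hasFDerivAt
  have h1 := HasFDerivAt.comp (f := fun a => prolongMap n (A.coordAct a) z) _ hLz
    ((A.contDiffAt_prolongMap_coordAct hn hM hz).differentiableAt (by simp)).hasFDerivAt
  have h2 : DifferentiableAt ℝ (fun a => (jetJacobian (A.coordAct a) z).det) (coordOne d G) :=
    (contDiff_det.contDiffAt.comp _ (contDiffAt_totalJacobian
      (A.contDiffAt_coordAct (A.coordOne_mem_coordDomain hz)) _)).differentiableAt (by simp)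
  have h3 := (h1.mul h2.hasFDerivAt).fderiv
  have hdet1 : (jetJacobian (A.coordAct (coordOne d G)) z).det = 1 := by
    rw [A.coordAct_coordOne_eq, jetJacobian,
      totalJacobian_of_eventuallyEq_id (A.act_one_eventuallyEq hM hz)]
    simp [ContinuousLinearMap.det]
  change fderiv ℝ ((L ∘ fun a => prolongMap n (A.coordAct a) z) *
    fun a => (jetJacobian (A.coordAct a) z).det) (coordOne d G) w = _
  rw [h3]
  simp only [_root_.add_apply, _root_.smul_apply, smul_eq_mul, Function.comp_apply, hP1, hdet1,
    A.fderiv_det_jetJacobian hn hM w hz, A.prolongField_generator hn hM w hz,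
    ContinuousLinearMap.comp_apply, one_mul]
  ring

/-- Local invariance is equivalent to the infinitesimal criterion. -/
theorem locallyInvariant_iff (hn : 1 ≤ n) (hM : IsOpen M) {L : JetSpace p q n → ℝ}
    (hL : ContDiffOn ℝ ∞ L (jetSet n M)) :
    A.LocallyInvariant L ↔ ∀ v ∈ A.generators, ∀ z ∈ jetSet n M,
      fderiv ℝ L z (prolongField n M v z) + L z * totalDiv hn (fun m => (v m).1) z = 0 := by
  constructor
  · rintro h _ ⟨w, rfl⟩ z hz
    rw [← A.fderiv_pullbackLagrangian hn hM hL w hz]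
    have hev : (fun a => pullbackLagrangian L (A.coordAct a) z) =ᶠ[𝓝 (coordOne d G)]
        fun _ => L z := (eventually_nhds_one_iff (d := d)).1 (h z hz)
    rw [hev.fderiv_eq, fderiv_fun_const]
    rfl
  · intro h z hz
    have hzero : ∀ z ∈ jetSet n M,
        fderiv ℝ (fun a => pullbackLagrangian L (A.coordAct a) z) (coordOne d G) = 0 := by
      intro z hz
      ext w
      rw [A.fderiv_pullbackLagrangian hn hM hL w hz]
      exact h _ ⟨w, rfl⟩ z hz
    rw [eventually_nhds_one_iff (d := d)]
    have hz' : z.base ∈ M := hz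
    set T := fun a => pullbackLagrangian L (A.coordAct a) z with hT
    have hTc : ContDiffAt ℝ ∞ T (coordOne d G) := A.contDiffAt_pullbackLagrangian hn hM hL hz
    have hTd : ∀ᶠ b in 𝓝 (coordOne d G), DifferentiableAt ℝ T b :=
      ((hTc.of_le (m := 1) (by simp)).eventually (by simp)).mono
        fun b hb => hb.differentiableAt (by simp)
    have hdom : ∀ᶠ b in 𝓝 (coordOne d G), (b, z.base) ∈ A.coordDomain := by
      have hc : ContinuousAt (fun b : EuclideanSpace ℝ (Fin d) => (b, z.base))
        (coordOne d G) := by fun_prop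
      exact hc.eventually (A.isOpen_coordDomain.mem_nhds (A.coordOne_mem_coordDomain hz'))
    have hdet : ∀ᶠ b in 𝓝 (coordOne d G), 0 < (jetJacobian (A.coordAct b) z).det :=
      (eventually_nhds_one_iff (d := d)).1
        (A.eventually_det_pos hM hz' (fderiv ℝ (taylorFun z) z.1))
    have hmul : ∀ᶠ b in 𝓝 (coordOne d G), ∀ᶠ a in 𝓝 (coordOne d G),
        ofCoord d G (coordMul d G (a, b)) = ofCoord d G a * ofCoord d G b := by
      have hswap : ContinuousAt (fun y : EuclideanSpace ℝ (Fin d) × EuclideanSpace ℝ (Fin d) =>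
        (y.2, y.1)) (coordOne d G, coordOne d G) := by fun_prop
      have := hswap.eventually (eventually_ofCoord_coordMul (d := d) (G := G))
      rw [nhds_prod_eq] at this
      exact this.curry
    -- The derivative of right translation by `b` is the identity at `b = e`, hence invertible
    -- nearby.
    have hinv : ∀ᶠ b in 𝓝 (coordOne d G),
        ((fderiv ℝ (coordMul d G) (coordOne d G, b)).comp
          (ContinuousLinearMap.inl ℝ _ (EuclideanSpace ℝ (Fin d)))).IsInvertible := by
      have hc : ContinuousAt (fun b => (fderiv ℝ (coordMul d G) (coordOne d G, b)).comp
          (ContinuousLinearMap.inl ℝ _ (EuclideanSpace ℝ (Fin d)))) (coordOne d G) := by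
        have h1 : ContinuousAt (fderiv ℝ (coordMul d G)) (coordOne d G, coordOne d G) :=
          (contDiffAt_coordMul.fderiv_right (m := 0) (by simp)).continuousAt
        have h2 : ContinuousAt (fun b => (coordOne d G, b)) (coordOne d G) := by fun_prop
        exact (ContinuousAt.comp (g := fderiv ℝ (coordMul d G)) h1 h2).clm_comp continuousAt_const
      refine hc.eventually (ContinuousLinearEquiv.isOpen.mem_nhds
        ⟨ContinuousLinearEquiv.refl ℝ _, ?_⟩)
      ext1 w
      exact (coordField_coordOne (G := G) w).symm
    -- By the cocycle identity, `a ↦ T (a b)` is the pulled back Lagrangian at the transformed jet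
    -- `z₁` times a constant, so its derivative at `a = e` vanishes; inverting right translation
    -- yields that of `T` at `b`.
    have hfd : ∀ᶠ b in 𝓝 (coordOne d G), DifferentiableAt ℝ T b ∧ fderiv ℝ T b = 0 := by
      filter_upwards [hTd, hdom, hdet, hmul, hinv,
        eventually_differentiableAt_coordMul (d := d) (G := G)] with b hb1 hb2 hb3 hb4 hb5 hb6
      refine ⟨hb1, ?_⟩
      have hz1 := A.prolongMap_mem_jetSet hn hb2.2 hb3.ne'
      set z₁ := prolongMap n (A.act (ofCoord d G b)) z
      have hbb : coordMul d G (coordOne d G, b) = b := coordMul_coordOne_left hb2.1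
      have hev : (T ∘ fun a => coordMul d G (a, b)) =ᶠ[𝓝 (coordOne d G)]
          fun a => pullbackLagrangian L (A.coordAct a) z₁ *
            (jetJacobian (A.coordAct b) z).det := by
        filter_upwards [hb4, (eventually_nhds_one_iff (d := d)).1
          (A.eventually_pullbackLagrangian_mul hn hM L hb2.2 hb3.ne')] with a ha1 ha2
        change pullbackLagrangian L (A.act (ofCoord d G (coordMul d G (a, b)))) z = _
        rw [ha1]
        exact ha2
      have d1 : HasFDerivAt T (fderiv ℝ T b) (coordMul d G (coordOne d G, b)) := by
        rw [hbb]
        exact hb1.hasFDerivAt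
      have d2 := HasFDerivAt.comp (f := fun a => coordMul d G (a, b)) (coordOne d G) d1
        (hasFDerivAt_coordMul_left hb6)
      have d3 : HasFDerivAt (fun a => pullbackLagrangian L (A.coordAct a) z₁)
          (0 : EuclideanSpace ℝ (Fin d) →L[ℝ] ℝ) (coordOne d G) := by
        rw [← hzero z₁ hz1]
        exact ((A.contDiffAt_pullbackLagrangian hn hM hL hz1).differentiableAt
          (by simp)).hasFDerivAt
      have d4 := (d3.mul_const (jetJacobian (A.coordAct b) z).det).congr_of_eventuallyEq hev
      have key := d2.unique d4
      obtain ⟨D, hD⟩ := hb5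
      rw [← hD, smul_zero] at key
      ext v
      have := congrArg (fun K => K (D.symm v)) key
      simpa using this
    obtain ⟨ε, hε, hball⟩ := Metric.eventually_nhds_iff_ball.1 hfd
    filter_upwards [Metric.ball_mem_nhds (coordOne d G) hε] with a ha
    have hconst := Metric.isOpen_ball.is_const_of_fderiv_eq_zero (𝕜 := ℝ) (f := T)
      (convex_ball (coordOne d G) ε).isPreconnected
      (fun b hb => (hball b hb).1.differentiableWithinAt) (fun b hb => (hball b hb).2) ha
      (Metric.mem_ball_self hε)
    refine hconst.trans ?_
    simp only [hT, pullbackLagrangian, A.coordAct_coordOne_eq, A.prolongMap_act_one hn hM hz]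
    rw [jetJacobian, totalJacobian_of_eventuallyEq_id (A.act_one_eventuallyEq hM hz')]
    simp [ContinuousLinearMap.det]

end LocalTransformationGroup

end VarSym

end

theorem mainTheorem10 {p q n d : ℕ} (hn : 1 ≤ n)
    {G : Type*} [TopologicalSpace G] [ChartedSpace (EuclideanSpace ℝ (Fin d)) G]
    [Group G] [LieGroup (𝓡 d) ∞ G]
    (Ω₀ : Set (VarSym.IndepVar p)) (hΩ₀ : IsOpen Ω₀)
    (M : Set (VarSym.TotalSpace p q)) (hM : IsOpen M) (hMΩ₀ : M ⊆ Ω₀ ×ˢ univ)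
    (L : VarSym.JetSpace p q n → ℝ) (hL : ContDiffOn ℝ ∞ L (VarSym.jetSet n M))
    (A : VarSym.LocalTransformationGroup d G M) (hA : A.Connected) :
    A.IsVariationalSymmetry Ω₀ L ↔
      ∀ v ∈ A.generators, ∀ z ∈ VarSym.jetSet n M,
        fderiv ℝ L z (VarSym.prolongField n M v z) +
          L z * VarSym.totalDiv hn (fun m => (v m).1) z = 0 := by
  rw [← A.locallyInvariant_iff hn hM hL]
  exact ⟨fun h => h.locallyInvariant hn hM hMΩ₀ hL, fun h => h.isVariationalSymmetry hn hM Ω₀⟩
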